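/- Let $S^k\subset\mathbb R^{k+1}$ be the unit sphere, with north pole $N_k=(0,\dots,0,1)$, and let $$\sigma_k:\mathbb R^k\to S^k,\qquad \sigma_k(x)=\left(\frac{2x}{|x|^2+1},\ \frac{|x|^2-1}{|x|^2+1}\right)$$ be (inverse) stereographic projection, a homeomorphism onto $S^k\setminus\{N_k\}$. A $C^2$ knot in $M$, where $M=S^3$ or $M=\mathbb R^3$, is a $C^2$ embedding $\alpha:S^1\to M$ (an injective $C^2$ map with nowhere vanishing derivative); a knot $\alpha$ in $\mathbb R^3$ is regarded as the knot $\sigma_3\circ\alpha$ in $S^3$. A polynomial knot is a smooth embedding $\kappa:\mathbb R\to\mathbb R^3$ whose three components are polynomials; its spherical completion is the map $\bar\kappa:S^1\to S^3$ with $\bar\kappa(\sigma_1(t))=\sigma_3(\kappa(t))$ for $t\in\mathbb R$ and $\bar\kappa(N_1)=N_3$. Two knots $\alpha_0,\alpha_1:S^1\to S^3$ have the same knot type if there are orientation-preserving homeomorphisms $f$ of $S^1$ and $g$ of $S^3$ with $\alpha_0=g\circ\alpha_1\circ f$. Proposition (Shastri). For every $C^2$ knot $\alpha$ in $S^3$ or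 in $\mathbb R^3$ there is a polynomial knot $\kappa:\mathbb R\to\mathbb R^3$ whose spherical completion $\bar\kappa$ has the same knot type as $\alpha$. -/

import Mathlib

open scoped Manifold ContDiff

noncomputable section

/-- Euclidean space `ℝⁿ`. -/
abbrev KnotEuclidean (n : ℕ) : Type := EuclideanSpace ℝ (Fin n)

/-- The unit sphere `Sⁿ ⊂ ℝⁿ⁺¹`, centred at the origin. -/
abbrev KnotSphere (n : ℕ) : Type := Metric.sphere (0 : EuclideanSpace ℝ (Fin (n + 1))) 1

/-- The coordinates `(2x / (|x|² + 1), (|x|² - 1) / (|x|² + 1))` of the point of `Sⁿ` that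
corresponds to `x ∈ ℝⁿ`. -/
def stereoCoords {n : ℕ} (x : KnotEuclidean n) : KnotEuclidean (n + 1) :=
  WithLp.toLp 2 (Fin.snoc (α := fun _ => ℝ) (fun i => 2 * x i / (‖x‖ ^ 2 + 1))
    ((‖x‖ ^ 2 - 1) / (‖x‖ ^ 2 + 1)))

theorem stereoCoords_mem {n : ℕ} (x : KnotEuclidean n) :
    stereoCoords x ∈ Metric.sphere (0 : EuclideanSpace ℝ (Fin (n + 1))) 1 := by
  have h0 : ‖x‖ ^ 2 + 1 ≠ 0 := by positivity
  have h1 : ∑ i, (2 * x i / (‖x‖ ^ 2 + 1)) ^ 2 = 4 * ‖x‖ ^ 2 / (‖x‖ ^ 2 + 1) ^ 2 := by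
    rw [EuclideanSpace.real_norm_sq_eq x, Finset.mul_sum, Finset.sum_div]
    exact Finset.sum_congr rfl fun i _ => by rw [div_pow]; ring
  have h2 : ‖stereoCoords x‖ ^ 2 = 1 := by
    rw [EuclideanSpace.real_norm_sq_eq, Fin.sum_univ_castSucc]
    simp only [stereoCoords, Fin.snoc_castSucc, Fin.snoc_last]
    rw [h1]
    field_simp
    ring
  rw [mem_sphere_zero_iff_norm]
  exact (sq_eq_sq₀ (norm_nonneg _) zero_le_one).1 (by rw [h2]; norm_num)

/-- Stereographic projection, as the inclusion `σ : ℝⁿ → Sⁿ` onto the complement of the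
north pole. -/
def stereoInclusion {n : ℕ} (x : KnotEuclidean n) : KnotSphere n :=
  ⟨stereoCoords x, stereoCoords_mem x⟩

/-- The north pole `(0, …, 0, 1)` of `Sⁿ`, the image of the point at infinity. -/
def northPole (n : ℕ) : KnotSphere n :=
  ⟨EuclideanSpace.single (Fin.last n) 1, by simp⟩

open Classical in
/-- The spherical completion `S¹ → Sⁿ` of a curve `κ : ℝ → ℝⁿ`: it takes the north pole to the
north pole, and any other point `p = σ(t)`, where `t = p₀ / (1 - p₁)`, to `σ(κ(t))`. -/
def sphericalCompletion {n : ℕ} (κ : ℝ → KnotEuclidean n) (p : KnotSphere 1) : KnotSphere n :=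
  if p = northPole 1 then northPole n
  else stereoInclusion (κ (p.1 0 / (1 - p.1 1)))

/-- A `C^k` embedding of manifolds: a `C^k` map that is an immersion (all its differentials are
injective) and a homeomorphism onto its image. -/
structure IsCkEmbedding {E H E' H' M N : Type*}
    [NormedAddCommGroup E] [NormedSpace ℝ E] [TopologicalSpace H]
    [NormedAddCommGroup E'] [NormedSpace ℝ E'] [TopologicalSpace H']
    [TopologicalSpace M] [ChartedSpace H M] [TopologicalSpace N] [ChartedSpace H' N]
    (I : ModelWithCorners ℝ E H) (J : ModelWithCorners ℝ E' H') (k : WithTop ℕ∞)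
    (f : M → N) : Prop where
  contMDiff : ContMDiff I J k f
  injective_mfderiv : ∀ x : M, Function.Injective (mfderiv I J f x)
  isEmbedding : Topology.IsEmbedding f

/-- A polynomial knot: a smooth embedding `ℝ → ℝⁿ` whose components are polynomials. -/
structure IsPolynomialKnot {n : ℕ} (κ : ℝ → KnotEuclidean n) : Prop where
  polynomial : ∃ P : Fin n → Polynomial ℝ, ∀ (t : ℝ) (i : Fin n), κ t i = (P i).eval t
  embedding : IsCkEmbedding 𝓘(ℝ, ℝ) 𝓘(ℝ, KnotEuclidean n) ∞ κ

/-- A self-homeomorphism of `Sⁿ` (`n ≥ 1`) preserves orientation if it has degree one, i.e. if it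
acts as the identity on the singular homology group `Hₙ(Sⁿ; ℤ)`. -/
def OrientationPreserving {n : ℕ} (g : KnotSphere n ≃ₜ KnotSphere n) : Prop :=
  ((AlgebraicTopology.singularHomologyFunctor (ModuleCat.{0} ℤ) n).obj (ModuleCat.of ℤ ℤ)).map
      (TopCat.ofHom (g : C(KnotSphere n, KnotSphere n))) =
    CategoryTheory.CategoryStruct.id _

/-- Two knots `S¹ → Sⁿ` have the same knot type if they differ by orientation-preserving
homeomorphisms of the circle and of the sphere. -/
def SameKnotType {n : ℕ} (α₀ α₁ : KnotSphere 1 → KnotSphere n) : Prop :=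
  ∃ (f : KnotSphere 1 ≃ₜ KnotSphere 1) (g : KnotSphere n ≃ₜ KnotSphere n),
    OrientationPreserving f ∧ OrientationPreserving g ∧ α₀ = g ∘ α₁ ∘ f

end

open scoped Manifold ContDiff
open Filter Topology

/-! ### Orientation-preserving homeomorphisms -/

/-! The argument needs only `C¹` regularity and works in `Sⁿ` for every `n ≥ 1`. Rotate the sphere
so that the knot takes the north pole to the north pole. Stereographic projection then turns it into
a long curve `β : ℝ → ℝⁿ`. Since the knot is regular at the pole, `β'` has the same limit `A` at
both ends (`exists_tendsto_deriv_stereoProj`). Since it is injective and regular on a compact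
circle, chordal distances are comparable, and this becomes `c |s - t| ≤ ‖β s - β t‖` on the line.

Approximate `β'` on a long interval `[-R, R]` by a polynomial curve `Q`, adding a small multiple of
a high even power of `t` in direction `A`. With a linear form `ℓ` such that `ℓ A = 1`, this keeps `ℓ
∘ Q` positive near both ends without spoiling the approximation (`exists_polyCurve_near_of_pos`).
The polynomial knot is a primitive `P` of `Q`.

No isotopy is followed; `P` is carried back to `β` by two explicit homeomorphisms, with the curve
`straighten P A R` in between. That curve differs from `β` by a map with small Lipschitz constant.
Extended from the image of `β` to all of `ℝⁿ`, the difference is a `1/2`-Lipschitz `φ`, and `id + φ`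
is a homeomorphism (`exists_homeomorph_of_lipschitz_perturbation`). The ends of `P` itself may run
far from the line, but they are graphs over the `ℓ`-axis, so a shear along the level sets of `ℓ`
straightens them after a reparametrization (`exists_homeomorph_straighten`). Thus `P = h ∘ β ∘ θ`,
which also shows that `P` is an embedding.

Orientation is handled by homotopy: a homeomorphism of `ℝⁿ` joined to the identity through uniformly
proper maps extends to a homeomorphism of `Sⁿ` homotopic to the identity, hence of degree one. -/

theorem OrientationPreserving.of_homotopy {n : ℕ} {g : KnotSphere n ≃ₜ KnotSphere n}
    (H : ContinuousMap.Homotopy (g : C(KnotSphere n, KnotSphere n)) (ContinuousMap.id _)) :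
    OrientationPreserving g := by
  have H' : TopCat.Homotopy (TopCat.ofHom (g : C(KnotSphere n, KnotSphere n)))
      (CategoryTheory.CategoryStruct.id (TopCat.of (KnotSphere n))) := H
  refine (H'.congr_homologyMap_singularChainComplexFunctor
    (ModuleCat.of ℤ ℤ : ModuleCat.{0} ℤ) n).trans ?_
  exact ((AlgebraicTopology.singularHomologyFunctor (ModuleCat.{0} ℤ) n).obj
    (ModuleCat.of ℤ ℤ)).map_id (TopCat.of (KnotSphere n))

theorem OrientationPreserving.trans {n : ℕ} {g h : KnotSphere n ≃ₜ KnotSphere n}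
    (hg : OrientationPreserving g) (hh : OrientationPreserving h) :
    OrientationPreserving (g.trans h) := by
  unfold OrientationPreserving at *
  have : TopCat.ofHom ((g.trans h : KnotSphere n ≃ₜ KnotSphere n) :
      C(KnotSphere n, KnotSphere n)) =
      CategoryTheory.CategoryStruct.comp
        (TopCat.ofHom (g : C(KnotSphere n, KnotSphere n)))
        (TopCat.ofHom (h : C(KnotSphere n, KnotSphere n))) := rfl
  rw [this, CategoryTheory.Functor.map_comp, hg, hh, CategoryTheory.Category.comp_id]

/-! ### Stereographic projection -/

section Stereographic

variable {n : ℕ}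

/-- Stereographic projection from the north pole, as a map on the ambient space. -/
noncomputable def stereoProj (y : KnotEuclidean (n + 1)) : KnotEuclidean n :=
  WithLp.toLp 2 fun i => y i.castSucc / (1 - y (Fin.last n))

theorem stereoCoords_castSucc (x : KnotEuclidean n) (i : Fin n) :
    stereoCoords x i.castSucc = 2 * x i / (‖x‖ ^ 2 + 1) := by
  simp [stereoCoords]

theorem stereoCoords_last (x : KnotEuclidean n) :
    stereoCoords x (Fin.last n) = (‖x‖ ^ 2 - 1) / (‖x‖ ^ 2 + 1) := by
  simp [stereoCoords]

theorem stereoProj_stereoCoords (x : KnotEuclidean n) : stereoProj (stereoCoords x) = x := by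
  ext i
  have h0 : ‖x‖ ^ 2 + 1 ≠ 0 := by positivity
  have h1 : 1 - (‖x‖ ^ 2 - 1) / (‖x‖ ^ 2 + 1) = 2 / (‖x‖ ^ 2 + 1) := by
    field_simp; ring
  simp only [stereoProj, stereoCoords_castSucc, stereoCoords_last, h1]
  field_simp

theorem continuous_stereoCoords : Continuous (stereoCoords (n := n)) := by
  refine (PiLp.continuous_toLp 2 _).comp (continuous_pi fun i => ?_)
  have h0 : ∀ x : KnotEuclidean n, ‖x‖ ^ 2 + 1 ≠ 0 := fun x => by positivity
  refine Fin.lastCases ?_ (fun j => ?_) i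
  · simp only [Fin.snoc_last]
    exact Continuous.div (by fun_prop) (by fun_prop) h0
  · simp only [Fin.snoc_castSucc]
    exact Continuous.div (by fun_prop) (by fun_prop) h0

theorem continuous_stereoInclusion : Continuous (stereoInclusion (n := n)) :=
  continuous_stereoCoords.subtype_mk _

theorem stereoCoords_norm_sub_sq (x y : KnotEuclidean n) :
    ‖stereoCoords x - stereoCoords y‖ ^ 2 =
      4 * ‖x - y‖ ^ 2 / ((‖x‖ ^ 2 + 1) * (‖y‖ ^ 2 + 1)) := by
  have hx0 : ‖x‖ ^ 2 + 1 ≠ 0 := by positivity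
  have hy0 : ‖y‖ ^ 2 + 1 ≠ 0 := by positivity
  have hxs := mem_sphere_zero_iff_norm.1 (stereoCoords_mem x)
  have hys := mem_sphere_zero_iff_norm.1 (stereoCoords_mem y)
  have hin : inner ℝ (stereoCoords x) (stereoCoords y) =
      (4 * inner ℝ x y + (‖x‖ ^ 2 - 1) * (‖y‖ ^ 2 - 1)) /
        ((‖x‖ ^ 2 + 1) * (‖y‖ ^ 2 + 1)) := by
    rw [PiLp.inner_apply, Fin.sum_univ_castSucc, PiLp.inner_apply]
    simp only [stereoCoords_castSucc, stereoCoords_last, RCLike.inner_apply, conj_trivial]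
    rw [add_div, Finset.mul_sum, Finset.sum_div]
    congr 1
    · exact Finset.sum_congr rfl fun i _ => by field_simp; ring
    · field_simp
  rw [norm_sub_sq_real, norm_sub_sq_real, hxs, hys, hin]
  field_simp
  ring

theorem stereoCoords_norm_sub_northPole_sq (x : KnotEuclidean n) :
    ‖stereoCoords x - (northPole n : KnotEuclidean (n + 1))‖ ^ 2 = 4 / (‖x‖ ^ 2 + 1) := by
  have hx0 : ‖x‖ ^ 2 + 1 ≠ 0 := by positivity
  have hxs := mem_sphere_zero_iff_norm.1 (stereoCoords_mem x)
  have hN : inner ℝ (stereoCoords x) (northPole n : KnotEuclidean (n + 1)) =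
      (‖x‖ ^ 2 - 1) / (‖x‖ ^ 2 + 1) := by
    simp only [northPole]
    rw [EuclideanSpace.inner_single_right]
    simp [stereoCoords_last]
  rw [norm_sub_sq_real, hxs, hN]
  rw [mem_sphere_zero_iff_norm.1 (northPole n).2]
  field_simp
  ring

theorem last_lt_one_of_ne_northPole {p : KnotSphere n} (hp : p ≠ northPole n) :
    p.1 (Fin.last n) < 1 := by
  have h1 : ‖p.1‖ = 1 := mem_sphere_zero_iff_norm.1 p.2
  have h2 : inner ℝ p.1 (northPole n : KnotEuclidean (n + 1)) = p.1 (Fin.last n) := by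
    simp only [northPole]
    rw [EuclideanSpace.inner_single_right]
    simp
  rw [← h2]
  refine lt_of_le_of_ne ?_ fun h => hp ?_
  · have := real_inner_le_norm p.1 (northPole n : KnotEuclidean (n + 1))
    rwa [h1, mem_sphere_zero_iff_norm.1 (northPole n).2, mul_one] at this
  · exact Subtype.ext ((inner_eq_one_iff_of_norm_eq_one h1
      (mem_sphere_zero_iff_norm.1 (northPole n).2)).1 h)

theorem norm_stereoProj_sq {y : KnotEuclidean (n + 1)} (hy : ‖y‖ = 1)
    (hl : y (Fin.last n) ≠ 1) :
    ‖stereoProj y‖ ^ 2 = (1 + y (Fin.last n)) / (1 - y (Fin.last n)) := by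
  have h0 : 1 - y (Fin.last n) ≠ 0 := sub_ne_zero.2 hl.symm
  have h1 : ∑ i : Fin n, y i.castSucc ^ 2 = 1 - y (Fin.last n) ^ 2 := by
    have := EuclideanSpace.real_norm_sq_eq y
    rw [hy, Fin.sum_univ_castSucc] at this
    linarith
  rw [EuclideanSpace.real_norm_sq_eq]
  simp only [stereoProj, div_pow]
  rw [← Finset.sum_div, h1]
  field_simp
  ring

theorem stereoInclusion_stereoProj {p : KnotSphere n} (hp : p ≠ northPole n) :
    stereoInclusion (stereoProj p.1) = p := by
  have hl := last_lt_one_of_ne_northPole hp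
  have h0 : 1 - p.1 (Fin.last n) ≠ 0 := by linarith
  have h1 := norm_stereoProj_sq (mem_sphere_zero_iff_norm.1 p.2) hl.ne
  have h2 : ‖stereoProj p.1‖ ^ 2 + 1 = 2 / (1 - p.1 (Fin.last n)) := by
    rw [h1]; field_simp; ring
  have h3 : ‖stereoProj p.1‖ ^ 2 - 1 = 2 * p.1 (Fin.last n) / (1 - p.1 (Fin.last n)) := by
    rw [h1]; field_simp; ring
  apply Subtype.ext
  ext i
  refine Fin.lastCases ?_ (fun j => ?_) i
  · simp only [stereoInclusion]
    rw [stereoCoords_last, h2, h3]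
    field_simp
  · simp only [stereoInclusion]
    rw [stereoCoords_castSucc, h2]
    simp only [stereoProj]
    field_simp

theorem stereoInclusion_ne_northPole (x : KnotEuclidean n) : stereoInclusion x ≠ northPole n := by
  intro h
  have h1 := stereoCoords_norm_sub_northPole_sq x
  have h2 : stereoCoords x = (northPole n : KnotEuclidean (n + 1)) := congrArg Subtype.val h
  rw [h2, sub_self, norm_zero] at h1
  have : 0 < 4 / (‖x‖ ^ 2 + 1) := by positivity
  simp at h1
  linarith

theorem stereoInclusion_injective : Function.Injective (stereoInclusion (n := n)) := by
  intro x y h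
  have h2 : stereoCoords x = stereoCoords y := congrArg Subtype.val h
  rw [← stereoProj_stereoCoords x, h2, stereoProj_stereoCoords]

theorem continuousOn_stereoProj :
    ContinuousOn (stereoProj (n := n)) {y | y (Fin.last n) ≠ 1} := by
  refine (PiLp.continuous_toLp 2 _).comp_continuousOn (continuousOn_pi.2 fun i => ?_)
  refine ContinuousOn.div (by fun_prop) (by fun_prop) fun y hy => sub_ne_zero.2 (Ne.symm hy)

/-- Points of the sphere near the north pole have large stereographic projection. -/
theorem eventually_le_norm_stereoProj (r : ℝ) :
    ∀ᶠ p : KnotSphere n in 𝓝 (northPole n), p ≠ northPole n → r ≤ ‖stereoProj p.1‖ := by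
  have hc : Continuous fun p : KnotSphere n => ‖p.1 - (northPole n : KnotEuclidean (n + 1))‖ ^ 2 := by
    fun_prop
  have h0 : ‖(northPole n : KnotEuclidean (n + 1)) - (northPole n : KnotEuclidean (n + 1))‖ ^ 2
      < 4 / (r ^ 2 + 1) := by
    rw [sub_self, norm_zero, zero_pow two_ne_zero]
    positivity
  filter_upwards [hc.continuousAt.eventually_lt continuousAt_const h0] with p hp hpN
  have h1 := stereoCoords_norm_sub_northPole_sq (stereoProj p.1)
  have h2 : stereoCoords (stereoProj p.1) = p.1 :=
    congrArg Subtype.val (stereoInclusion_stereoProj hpN)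
  rw [h2] at h1
  rw [h1, div_lt_div_iff_of_pos_left (by norm_num) (by positivity) (by positivity)] at hp
  exact le_of_lt (lt_of_pow_lt_pow_left₀ 2 (norm_nonneg _) (by linarith))

/-- Points of large norm are close to the north pole on the sphere. -/
theorem exists_forall_stereoInclusion_mem {U : Set (KnotSphere n)} (hU : U ∈ 𝓝 (northPole n)) :
    ∃ M : ℝ, ∀ x : KnotEuclidean n, M ≤ ‖x‖ → stereoInclusion x ∈ U := by
  obtain ⟨ε, hε, hεU⟩ := Metric.mem_nhds_iff.1 hU
  refine ⟨2 / ε, fun x hx => hεU ?_⟩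
  rw [Metric.mem_ball, Subtype.dist_eq, dist_eq_norm]
  refine lt_of_pow_lt_pow_left₀ 2 hε.le ?_
  refine (stereoCoords_norm_sub_northPole_sq x).trans_lt ?_
  rw [div_lt_iff₀ (by positivity)]
  have h1 : 2 ≤ ε * ‖x‖ := by
    rw [div_le_iff₀ hε] at hx
    linarith
  have h2 : (0 : ℝ) < ε ^ 2 := by positivity
  nlinarith

open Classical in
/-- The extension to the sphere of a self-map of Euclidean space, fixing the north pole. -/
noncomputable def sphereExtend (h : KnotEuclidean n → KnotEuclidean n) (p : KnotSphere n) :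
    KnotSphere n :=
  if p = northPole n then northPole n else stereoInclusion (h (stereoProj p.1))

theorem sphereExtend_northPole (h : KnotEuclidean n → KnotEuclidean n) :
    sphereExtend h (northPole n) = northPole n := by
  simp [sphereExtend]

theorem sphereExtend_stereoInclusion (h : KnotEuclidean n → KnotEuclidean n)
    (x : KnotEuclidean n) : sphereExtend h (stereoInclusion x) = stereoInclusion (h x) := by
  rw [sphereExtend, if_neg (stereoInclusion_ne_northPole x)]
  congr 2
  exact stereoProj_stereoCoords x

theorem sphere_cases (p : KnotSphere n) :
    p = northPole n ∨ ∃ x : KnotEuclidean n, p = stereoInclusion x := by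
  by_cases hp : p = northPole n
  · exact Or.inl hp
  · exact Or.inr ⟨_, (stereoInclusion_stereoProj hp).symm⟩

/-- A uniformly proper continuous family of self-maps of Euclidean space extends to a continuous
family of self-maps of the sphere. -/
theorem continuous_sphereExtend {T : Type*} [TopologicalSpace T]
    {H : T × KnotEuclidean n → KnotEuclidean n} (hH : Continuous H)
    (hp : ∀ M : ℝ, ∃ r : ℝ, ∀ t x, r ≤ ‖x‖ → M ≤ ‖H (t, x)‖) :
    Continuous fun q : T × KnotSphere n => sphereExtend (fun x => H (q.1, x)) q.2 := by
  rw [continuous_iff_continuousAt]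
  rintro ⟨t, p⟩
  by_cases h : p = northPole n
  · subst h
    rw [ContinuousAt, sphereExtend_northPole]
    intro U hU
    obtain ⟨M, hM⟩ := exists_forall_stereoInclusion_mem hU
    -- The radius `r` does not depend on the parameter, so one neighbourhood of the pole serves all
    -- nearby parameters.
    obtain ⟨r, hr⟩ := hp M
    have h1 : ∀ᶠ q : T × KnotSphere n in 𝓝 (t, northPole n),
        q.2 ≠ northPole n → r ≤ ‖stereoProj q.2.1‖ :=
      (continuous_snd.tendsto (t, northPole n)).eventually (eventually_le_norm_stereoProj r)
    rw [mem_map]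
    filter_upwards [h1] with q hq
    by_cases hq2 : q.2 = northPole n
    · simp only [Set.mem_preimage, hq2, sphereExtend_northPole]
      exact mem_of_mem_nhds hU
    · simp only [Set.mem_preimage, sphereExtend, if_neg hq2]
      exact hM _ (hr _ _ (hq hq2))
  · have hne : ∀ᶠ q : T × KnotSphere n in 𝓝 (t, p), q.2 ≠ northPole n :=
      (continuous_snd.tendsto (t, p)).eventually (isOpen_ne.mem_nhds h)
    have hproj : ContinuousAt (fun q : T × KnotSphere n => stereoProj q.2.1) (t, p) := by
      have hopen : IsOpen {y : KnotEuclidean (n + 1) | y (Fin.last n) ≠ 1} :=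
        isOpen_ne_fun (by fun_prop) (by fun_prop)
      have h2 : ContinuousAt (stereoProj (n := n)) p.1 :=
        continuousOn_stereoProj.continuousAt
          (hopen.mem_nhds (last_lt_one_of_ne_northPole h).ne)
      exact ContinuousAt.comp (f := fun q : T × KnotSphere n => q.2.1) (x := (t, p)) h2
        (by fun_prop)
    have h3 : ContinuousAt (fun q : T × KnotSphere n =>
        stereoInclusion (H (q.1, stereoProj q.2.1))) (t, p) :=
      continuous_stereoInclusion.continuousAt.comp
        (hH.continuousAt.comp (continuousAt_fst.prodMk hproj))
    refine h3.congr ?_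
    filter_upwards [hne] with q hq
    simp only [sphereExtend, if_neg hq]

/-- The preimage of a closed ball is compact, hence bounded. This is the properness that a single
homeomorphism needs in order to extend over the pole. -/
theorem exists_le_norm_homeomorph (h : KnotEuclidean n ≃ₜ KnotEuclidean n) (M : ℝ) :
    ∃ r : ℝ, ∀ x, r ≤ ‖x‖ → M ≤ ‖h x‖ := by
  have hK : IsCompact (h.symm '' Metric.closedBall 0 M) :=
    (isCompact_closedBall _ _).image h.symm.continuous
  obtain ⟨r, hr⟩ := hK.isBounded.exists_norm_le
  refine ⟨r + 1, fun x hx => ?_⟩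
  by_contra! hlt
  have := hr x ⟨h x, by simpa using hlt.le, by simp⟩
  linarith

/-- The extension to the sphere of a self-homeomorphism of Euclidean space. -/
noncomputable def sphereHomeo (h : KnotEuclidean n ≃ₜ KnotEuclidean n) :
    KnotSphere n ≃ₜ KnotSphere n where
  toFun := sphereExtend h
  invFun := sphereExtend h.symm
  left_inv p := by
    rcases sphere_cases p with rfl | ⟨x, rfl⟩
    · simp [sphereExtend_northPole]
    · simp [sphereExtend_stereoInclusion]
  right_inv p := by
    rcases sphere_cases p with rfl | ⟨x, rfl⟩
    · simp [sphereExtend_northPole]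
    · simp [sphereExtend_stereoInclusion]
  continuous_toFun := by
    have := continuous_sphereExtend (T := Unit) (H := fun q => h q.2) (by fun_prop)
      (fun M => (exists_le_norm_homeomorph h M).imp fun r hr _ x => hr x)
    exact this.comp (Continuous.prodMk_right ())
  continuous_invFun := by
    have := continuous_sphereExtend (T := Unit) (H := fun q => h.symm q.2) (by fun_prop)
      (fun M => (exists_le_norm_homeomorph h.symm M).imp fun r hr _ x => hr x)
    exact this.comp (Continuous.prodMk_right ())

theorem sphereHomeo_northPole (h : KnotEuclidean n ≃ₜ KnotEuclidean n) :
    sphereHomeo h (northPole n) = northPole n :=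
  sphereExtend_northPole _

theorem sphereHomeo_stereoInclusion (h : KnotEuclidean n ≃ₜ KnotEuclidean n)
    (x : KnotEuclidean n) : sphereHomeo h (stereoInclusion x) = stereoInclusion (h x) :=
  sphereExtend_stereoInclusion _ _

/-- A homeomorphism of Euclidean space that is homotopic to the identity through uniformly proper
maps extends to an orientation-preserving homeomorphism of the sphere. -/
theorem orientationPreserving_sphereHomeo (h : KnotEuclidean n ≃ₜ KnotEuclidean n)
    (H : ℝ × KnotEuclidean n → KnotEuclidean n) (hH : Continuous H)
    (h0 : ∀ x, H (0, x) = x) (h1 : ∀ x, H (1, x) = h x)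
    (hp : ∀ M : ℝ, ∃ r : ℝ, ∀ t ∈ Set.Icc (0 : ℝ) 1, ∀ x, r ≤ ‖x‖ → M ≤ ‖H (t, x)‖) :
    OrientationPreserving (sphereHomeo h) := by
  have hc := continuous_sphereExtend (T := unitInterval) (H := fun q => H (q.1, q.2))
    (by fun_prop) (fun M => (hp M).imp fun r hr t x => hr t t.2 x)
  refine OrientationPreserving.of_homotopy (ContinuousMap.Homotopy.symm
    { toFun := _, continuous_toFun := hc, map_zero_left := fun p => ?_,
      map_one_left := fun p => ?_ })
  · rcases sphere_cases p with rfl | ⟨x, rfl⟩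
    · exact sphereExtend_northPole _
    · refine (sphereExtend_stereoInclusion _ _).trans ?_
      simp [h0]
  · rcases sphere_cases p with rfl | ⟨x, rfl⟩
    · exact (sphereExtend_northPole _).trans (sphereHomeo_northPole h).symm
    · refine (sphereExtend_stereoInclusion _ _).trans ?_
      simp [h1, sphereHomeo_stereoInclusion]

theorem sphereHomeo_trans (h k : KnotEuclidean n ≃ₜ KnotEuclidean n) :
    sphereHomeo (h.trans k) = (sphereHomeo h).trans (sphereHomeo k) := by
  ext1 p
  rcases sphere_cases p with rfl | ⟨x, rfl⟩
  · simp [sphereHomeo_northPole]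
  · simp [sphereHomeo_stereoInclusion]

end Stereographic

/-! ### Homeomorphisms of Euclidean space properly homotopic to the identity -/

section Homeomorphisms

variable {n : ℕ}

/-- The identity plus a Lipschitz map of constant `1 / 2` is a homeomorphism. -/
noncomputable def lipschitzPerturbation (φ : KnotEuclidean n → KnotEuclidean n)
    (hφ : LipschitzWith (1 / 2) φ) : KnotEuclidean n ≃ₜ KnotEuclidean n :=
  ApproximatesLinearOn.toHomeomorph (𝕜 := ℝ) (fun x => x + φ x)
    (f' := ContinuousLinearEquiv.refl ℝ (KnotEuclidean n)) (c := 1 / 2)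
    (by
      intro x _ y _
      have h := hφ.norm_sub_le x y
      have e : x + φ x - (y + φ y) - (x - y) = φ x - φ y := by abel
      rwa [← e] at h)
    (by
      rcases subsingleton_or_nontrivial (KnotEuclidean n) with h | h
      · exact Or.inl h
      · right
        have : ‖((ContinuousLinearEquiv.refl ℝ (KnotEuclidean n)).symm :
            KnotEuclidean n →L[ℝ] KnotEuclidean n)‖₊ = 1 := by
          ext
          exact ContinuousLinearMap.norm_id
        rw [this, inv_one]
        exact NNReal.half_lt_self one_ne_zero)

theorem lipschitzPerturbation_apply (φ : KnotEuclidean n → KnotEuclidean n)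
    (hφ : LipschitzWith (1 / 2) φ) (x : KnotEuclidean n) :
    lipschitzPerturbation φ hφ x = x + φ x := rfl

theorem orientationPreserving_lipschitzPerturbation (φ : KnotEuclidean n → KnotEuclidean n)
    (hφ : LipschitzWith (1 / 2) φ) :
    OrientationPreserving (sphereHomeo (lipschitzPerturbation φ hφ)) := by
  have hc := hφ.continuous
  refine orientationPreserving_sphereHomeo _ (fun q => q.2 + q.1 • φ q.2) (by fun_prop)
    (fun x => by simp) (fun x => by simp [lipschitzPerturbation_apply]) fun M => ?_
  -- From `‖φ x‖ ≤ ‖x‖ / 2 + ‖φ 0‖`, every stage of the homotopy has norm at least `‖x‖ / 2 - ‖φ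
  -- 0‖`.
  refine ⟨2 * (M + ‖φ 0‖), fun t ht x hx => ?_⟩
  have h1 : ‖φ x - φ 0‖ ≤ 1 / 2 * ‖x‖ := by
    simpa using hφ.norm_sub_le x 0
  have h2 : ‖φ x‖ ≤ ‖φ x - φ 0‖ + ‖φ 0‖ := by
    simpa using norm_add_le (φ x - φ 0) (φ 0)
  have h3 : ‖t • φ x‖ ≤ ‖φ x‖ := by
    rw [norm_smul, Real.norm_of_nonneg ht.1]
    exact mul_le_of_le_one_left (norm_nonneg _) ht.2
  have h4 : ‖x‖ ≤ ‖x + t • φ x‖ + ‖t • φ x‖ := by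
    simpa using norm_sub_le (x + t • φ x) (t • φ x)
  simp only
  linarith

/-- A perturbation of a curve which is Lipschitz-small compared to the curve extends to a
homeomorphism of the ambient space. -/
theorem exists_homeomorph_of_lipschitz_perturbation {β δ : ℝ → KnotEuclidean n} {c K : ℝ}
    (hc : 0 < c) (hβ : ∀ s t, c * |s - t| ≤ ‖β s - β t‖)
    (hδ : ∀ s t, ‖δ s - δ t‖ ≤ K * |s - t|)
    (hK : lipschitzExtensionConstant (KnotEuclidean n) * K ≤ c / 2) :
    ∃ h : KnotEuclidean n ≃ₜ KnotEuclidean n, OrientationPreserving (sphereHomeo h) ∧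
      ∀ t, h (β t) = β t + δ t := by
  have hK0 : 0 ≤ K := by
    have := (norm_nonneg _).trans (hδ 1 0)
    simpa using this
  have hinj : Function.Injective β := fun s t hst => by
    have := hβ s t
    rw [hst, sub_self, norm_zero] at this
    have h2 : |s - t| ≤ 0 := by
      by_contra! h
      nlinarith
    exact sub_eq_zero.1 (abs_nonpos_iff.1 h2)
  have hleft : ∀ t, Function.invFun β (β t) = t := Function.leftInverse_invFun hinj
  -- Expansion of `β` makes `β⁻¹` Lipschitz with constant `1 / c` on the image. Extending to the
  -- whole space costs the factor `lipschitzExtensionConstant`, which `hK` allows for.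
  have hLip : LipschitzOnWith (Real.toNNReal (K / c)) (fun x => δ (Function.invFun β x))
      (Set.range β) := by
    refine LipschitzOnWith.of_dist_le_mul ?_
    rintro _ ⟨s, rfl⟩ _ ⟨t, rfl⟩
    rw [hleft, hleft, dist_eq_norm, dist_eq_norm, Real.coe_toNNReal _ (by positivity)]
    refine (hδ s t).trans ?_
    rw [div_mul_eq_mul_div, le_div_iff₀ hc]
    nlinarith [hβ s t]
  obtain ⟨φ, hφ, hφδ⟩ := hLip.extend_finite_dimension
  have hφ' : LipschitzWith (1 / 2) φ := by
    refine hφ.weaken ?_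
    rw [← NNReal.coe_le_coe]
    push_cast
    rw [Real.coe_toNNReal _ (by positivity), mul_div_assoc', div_le_iff₀ hc]
    linarith
  refine ⟨_, orientationPreserving_lipschitzPerturbation φ hφ', fun t => ?_⟩
  rw [lipschitzPerturbation_apply, ← hφδ ⟨t, rfl⟩]
  simp only [hleft]

/-- The shear `x ↦ x + a (ℓ x)` along the level sets of a linear form `ℓ`. -/
def shear (ℓ : KnotEuclidean n →L[ℝ] ℝ) (a : ℝ → KnotEuclidean n) (ha : Continuous a)
    (hℓ : ∀ z, ℓ (a z) = 0) : KnotEuclidean n ≃ₜ KnotEuclidean n where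
  toFun x := x + a (ℓ x)
  invFun x := x - a (ℓ x)
  left_inv x := by simp [hℓ]
  right_inv x := by simp [hℓ]
  continuous_toFun := by fun_prop
  continuous_invFun := by fun_prop

theorem orientationPreserving_shear (ℓ : KnotEuclidean n →L[ℝ] ℝ) (a : ℝ → KnotEuclidean n)
    (ha : Continuous a) (hℓ : ∀ z, ℓ (a z) = 0) :
    OrientationPreserving (sphereHomeo (shear ℓ a ha hℓ)) := by
  refine orientationPreserving_sphereHomeo _ (fun q => q.2 + q.1 • a (ℓ q.2)) (by fun_prop)
    (fun x => by simp) (fun x => by simp [shear]) fun M => ?_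
  -- The function `a` may be unbounded, but `ℓ` is preserved along the homotopy: if the image has
  -- norm below `M`, then `|ℓ x| ≤ ‖ℓ‖ * M`, and only this range of `a` matters.
  obtain ⟨C, hC⟩ := (isCompact_closedBall (0 : ℝ) (‖ℓ‖ * M)).exists_bound_of_continuousOn
    ha.continuousOn
  refine ⟨M + C, fun t ht x hx => ?_⟩
  by_contra! hlt
  simp only at hlt
  have h1 : ℓ (x + t • a (ℓ x)) = ℓ x := by simp [hℓ]
  have h2 : ‖ℓ x‖ ≤ ‖ℓ‖ * M := by
    rw [← h1]
    exact (ℓ.le_opNorm _).trans (by gcongr)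
  have h3 := hC (ℓ x) (by simpa using h2)
  have h4 : ‖t • a (ℓ x)‖ ≤ ‖a (ℓ x)‖ := by
    rw [norm_smul, Real.norm_of_nonneg ht.1]
    exact mul_le_of_le_one_left (norm_nonneg _) ht.2
  have h5 : ‖x‖ ≤ ‖x + t • a (ℓ x)‖ + ‖t • a (ℓ x)‖ := by
    simpa using norm_sub_le (x + t • a (ℓ x)) (t • a (ℓ x))
  linarith

/-- The real line as one-dimensional Euclidean space. -/
noncomputable def lineHomeo : ℝ ≃ₜ KnotEuclidean 1 where
  toFun t := EuclideanSpace.single 0 t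
  invFun x := x 0
  left_inv t := by simp
  right_inv x := by
    ext i
    fin_cases i
    simp
  continuous_toFun := by
    refine (PiLp.continuous_toLp 2 _).comp (continuous_pi fun i => ?_)
    fin_cases i
    simpa using continuous_id'
  continuous_invFun := by fun_prop

theorem norm_lineHomeo (t : ℝ) : ‖lineHomeo t‖ = |t| := by
  change ‖EuclideanSpace.single (0 : Fin 1) t‖ = |t|
  simp

theorem lineHomeo_sub (s t : ℝ) : lineHomeo (s - t) = lineHomeo s - lineHomeo t := by
  ext i
  fin_cases i
  exact (lineHomeo.symm_apply_apply (s - t)).trans (congrArg₂ (· - ·)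
    (lineHomeo.symm_apply_apply s).symm (lineHomeo.symm_apply_apply t).symm)

/-- A homeomorphism of the line that preserves both ends extends to an orientation-preserving
homeomorphism of the circle. -/
theorem orientationPreserving_line (θ : ℝ ≃ₜ ℝ) (htop : Tendsto θ atTop atTop)
    (hbot : Tendsto θ atBot atBot) :
    OrientationPreserving (sphereHomeo ((lineHomeo.symm.trans θ).trans lineHomeo)) := by
  refine orientationPreserving_sphereHomeo _ (fun q => lineHomeo
      ((1 - q.1) * lineHomeo.symm q.2 + q.1 * θ (lineHomeo.symm q.2))) (by fun_prop)
    (fun x => by simp) (fun x => by simp) fun M => ?_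
  obtain ⟨r₁, h₁⟩ := eventually_atTop.1 (htop.eventually_ge_atTop M)
  obtain ⟨r₂, h₂⟩ := eventually_atBot.1 (hbot.eventually_le_atBot (-M))
  refine ⟨max (max r₁ (-r₂)) M, fun t ht x hx => ?_⟩
  obtain ⟨u, rfl⟩ := lineHomeo.surjective x
  rw [norm_lineHomeo] at hx ⊢
  rw [Homeomorph.symm_apply_apply]
  obtain ⟨⟨hx1, hx2⟩, hx3⟩ : (r₁ ≤ |u| ∧ -r₂ ≤ |u|) ∧ M ≤ |u| := by simpa using hx
  rcases le_total 0 u with hu | hu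
  · rw [abs_of_nonneg hu] at hx1 hx3
    refine le_trans ?_ (le_abs_self _)
    nlinarith [h₁ u hx1, ht.1, ht.2]
  · rw [abs_of_nonpos hu] at hx2 hx3
    refine le_trans ?_ (neg_le_abs _)
    nlinarith [h₂ u (by linarith), ht.1, ht.2]

end Homeomorphisms

/-! ### Polynomial approximation with control at infinity -/

section Polynomial

open Polynomial

theorem exists_polynomial_derivative_eq (q : ℝ[X]) : ∃ p : ℝ[X], derivative p = q := by
  induction q using Polynomial.induction_on' with
  | add q₁ q₂ h₁ h₂ =>
    obtain ⟨p₁, rfl⟩ := h₁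
    obtain ⟨p₂, rfl⟩ := h₂
    exact ⟨p₁ + p₂, derivative_add⟩
  | monomial k a =>
    refine ⟨monomial (k + 1) (a / (k + 1)), ?_⟩
    have : (k : ℝ) + 1 ≠ 0 := by positivity
    rw [derivative_monomial]
    congr 1
    push_cast
    field_simp

/-- A polynomial is bounded on `|t| ≥ S + 1` by a small multiple of an even power of `t / S`. -/
theorem exists_abs_eval_lt_mul_pow (q : ℝ[X]) {S η : ℝ} (hS : 0 < S) (hη : 0 < η) :
    ∃ m : ℕ, ∀ t : ℝ, S + 1 ≤ |t| → |q.eval t| < η * (t / S) ^ (2 * m) := by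
  set C : ℝ := ∑ i ∈ Finset.range (q.natDegree + 1), |q.coeff i| * S ^ i
  have hρ : 1 < (S + 1) / S := by rw [one_lt_div hS]; linarith
  obtain ⟨k, hk⟩ := pow_unbounded_of_one_lt (C / η) hρ
  -- With `u = |t| / S`, bounded below by `(S + 1) / S > 1`, the factor `u ^ (2 * q.natDegree + k)`
  -- absorbs the growth of `q` and the remaining `u ^ k` beats the constant `C / η`.
  refine ⟨q.natDegree + k, fun t ht => ?_⟩
  have ht0 : 0 < |t| := by linarith
  set u : ℝ := |t| / S with hu
  have hu1 : (S + 1) / S ≤ u := by rw [hu]; gcongr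
  have hu2 : 1 ≤ u := hρ.le.trans hu1
  have hu0 : 0 < u := by positivity
  have hCn : 0 ≤ C := Finset.sum_nonneg fun i _ => by positivity
  have hpow : (t / S) ^ (2 * (q.natDegree + k)) = u ^ (2 * q.natDegree + k + k) := by
    rw [hu, ← abs_of_pos hS, ← abs_div, abs_of_pos hS,
      show 2 * q.natDegree + k + k = 2 * (q.natDegree + k) by ring, pow_mul, pow_mul, sq_abs]
  have h1 : |q.eval t| ≤ C * u ^ (2 * q.natDegree + k) := by
    rw [eval_eq_sum_range, Finset.sum_mul]
    refine (Finset.abs_sum_le_sum_abs _ _).trans (Finset.sum_le_sum fun i hi => ?_)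
    rw [abs_mul, abs_pow, mul_assoc]
    refine mul_le_mul_of_nonneg_left ?_ (abs_nonneg _)
    have h2 : |t| = S * u := by rw [hu]; field_simp
    rw [h2, mul_pow]
    refine mul_le_mul_of_nonneg_left (pow_le_pow_right₀ hu2 ?_) (by positivity)
    have := Finset.mem_range.1 hi
    omega
  have h2 : C < η * u ^ k := by
    have : C / η < u ^ k := hk.trans_le (pow_le_pow_left₀ (by positivity) hu1 k)
    rwa [div_lt_iff₀ hη, mul_comm] at this
  rw [hpow, pow_add _ _ k]
  calc |q.eval t| ≤ C * u ^ (2 * q.natDegree + k) := h1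
    _ < (η * u ^ k) * u ^ (2 * q.natDegree + k) := by gcongr
    _ = η * (u ^ (2 * q.natDegree + k) * u ^ k) := by ring

variable {n : ℕ}

/-- The polynomial curve with given components. -/
noncomputable def polyCurve (Q : Fin n → ℝ[X]) (t : ℝ) : KnotEuclidean n :=
  WithLp.toLp 2 fun i => (Q i).eval t

theorem EuclideanSpace.norm_le_sum_abs (x : KnotEuclidean n) : ‖x‖ ≤ ∑ i, |x i| := by
  have h : x = ∑ i, EuclideanSpace.single i (x i) := by
    ext j
    simp
  calc ‖x‖ = ‖∑ i, EuclideanSpace.single i (x i)‖ := by rw [← h]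
    _ ≤ ∑ i, ‖EuclideanSpace.single i (x i)‖ := norm_sum_le _ _
    _ = ∑ i, |x i| := by simp

theorem exists_polyCurve_near {v : ℝ → KnotEuclidean n} (hv : Continuous v) (S : ℝ) {ε : ℝ}
    (hε : 0 < ε) : ∃ Q : Fin n → ℝ[X], ∀ t, |t| ≤ S → ‖polyCurve Q t - v t‖ ≤ ε := by
  have hn : (0 : ℝ) < n + 1 := by positivity
  have h : ∀ i : Fin n, ∃ p : ℝ[X], ∀ t ∈ Set.Icc (-S) S, |p.eval t - v t i| < ε / (n + 1) :=
    fun i => exists_polynomial_near_of_continuousOn _ _ (fun t => v t i)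
      (by fun_prop) _ (by positivity)
  choose Q hQ using h
  refine ⟨Q, fun t ht => (EuclideanSpace.norm_le_sum_abs _).trans ?_⟩
  calc ∑ i, |(polyCurve Q t - v t) i| ≤ ∑ _i : Fin n, ε / (n + 1) :=
        Finset.sum_le_sum fun i _ => (hQ i t (abs_le.1 ht)).le
    _ = n * ε / (n + 1) := by simp [mul_div_assoc]
    _ ≤ ε := by
      rw [div_le_iff₀ hn]
      nlinarith

theorem exists_polynomial_linearForm (ℓ : KnotEuclidean n →L[ℝ] ℝ) (Q : Fin n → ℝ[X]) :
    ∃ q : ℝ[X], ∀ t, q.eval t = ℓ (polyCurve Q t) := by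
  refine ⟨∑ i, C (ℓ (EuclideanSpace.single i 1)) * Q i, fun t => ?_⟩
  have h : polyCurve Q t = ∑ i, (Q i).eval t • EuclideanSpace.single i (1 : ℝ) := by
    ext j
    simp [polyCurve, Pi.single_apply]
  rw [h, map_sum, eval_finsetSum]
  refine Finset.sum_congr rfl fun i _ => ?_
  rw [map_smul, eval_mul, eval_C, smul_eq_mul, mul_comm]

/-- A continuous curve whose image under `ℓ` is at least `1 / 2` for `|t| ≥ R` is uniformly
approximated on `[-S, S]` by a polynomial curve whose image under `ℓ` is at least `1 / 4` for
all `|t| ≥ R`. -/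
theorem exists_polyCurve_near_of_pos {v : ℝ → KnotEuclidean n} (hv : Continuous v)
    (ℓ : KnotEuclidean n →L[ℝ] ℝ) {A : KnotEuclidean n} (hA : ℓ A = 1) {R S ε : ℝ}
    (hS : 0 < S) (hε : 0 < ε) (hℓε : ‖ℓ‖ * ε ≤ 1 / 2)
    (hR : ∀ t, R ≤ |t| → 1 / 2 ≤ ℓ (v t)) :
    ∃ Q : Fin n → ℝ[X], (∀ t, |t| ≤ S → ‖polyCurve Q t - v t‖ ≤ ε) ∧
      ∀ t, R ≤ |t| → 1 / 4 ≤ ℓ (polyCurve Q t) := by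
  -- The unit margin beyond `S` leaves room for the correction `η (t / S) ^ (2 m) • A`, which is at
  -- most `ε / 2` for `|t| ≤ S`, to become dominant by `|t| = S + 1`. In the margin `Q₀` is still
  -- controlled by `v`, and the even power only increases `ℓ`.
  obtain ⟨Q₀, hQ₀⟩ := exists_polyCurve_near hv (S + 1) (half_pos hε)
  obtain ⟨q, hq⟩ := exists_polynomial_linearForm ℓ Q₀
  set η : ℝ := ε / 2 / (‖A‖ + 1) with hη
  have hη0 : 0 < η := by positivity
  have hηA : η * ‖A‖ ≤ ε / 2 := by
    rw [hη, div_mul_eq_mul_div, div_le_iff₀ (by positivity)]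
    nlinarith [norm_nonneg A]
  -- Subtracting `1 / 4` here makes the domination give exactly `1 / 4 ≤ ℓ` past `S + 1`.
  obtain ⟨m, hm⟩ := exists_abs_eval_lt_mul_pow (q - C (1 / 4)) hS hη0
  have hQ : ∀ t, polyCurve (fun i => Q₀ i + C (η * A i / S ^ (2 * m)) * X ^ (2 * m)) t =
      polyCurve Q₀ t + (η * (t / S) ^ (2 * m)) • A := by
    intro t
    ext i
    simp only [polyCurve, eval_add, eval_mul, eval_C, eval_pow, eval_X, PiLp.add_apply,
      PiLp.smul_apply, smul_eq_mul]
    rw [div_pow]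
    ring
  refine ⟨fun i => Q₀ i + C (η * A i / S ^ (2 * m)) * X ^ (2 * m), fun t ht => ?_,
    fun t ht => ?_⟩
  · rw [hQ, add_sub_right_comm]
    have h1 : (t / S) ^ (2 * m) ≤ 1 := by
      rw [pow_mul]
      refine pow_le_one₀ (sq_nonneg _) ?_
      rw [sq_le_one_iff_abs_le_one, abs_div, abs_of_pos hS]
      exact (div_le_one hS).2 ht
    have h2 : 0 ≤ (t / S) ^ (2 * m) := by
      rw [pow_mul]
      positivity
    have h3 : ‖(η * (t / S) ^ (2 * m)) • A‖ ≤ ε / 2 := by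
      rw [norm_smul, Real.norm_of_nonneg (by positivity)]
      refine le_trans ?_ hηA
      exact mul_le_mul_of_nonneg_right (mul_le_of_le_one_right hη0.le h1) (norm_nonneg _)
    have := hQ₀ t (by linarith)
    linarith [norm_add_le (polyCurve Q₀ t - v t) ((η * (t / S) ^ (2 * m)) • A)]
  · rw [hQ, map_add, map_smul, hA, smul_eq_mul, mul_one]
    rcases le_total |t| (S + 1) with h | h
    · have h1 : ‖ℓ (polyCurve Q₀ t - v t)‖ ≤ 1 / 4 := by
        refine (ℓ.le_opNorm _).trans ?_
        refine (mul_le_mul_of_nonneg_left (hQ₀ t h) (norm_nonneg _)).trans ?_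
        linarith
      rw [map_sub] at h1
      have h2 := (abs_le.1 h1).1
      have h3 : 0 ≤ (t / S) ^ (2 * m) := by
        rw [pow_mul]
        positivity
      have := hR t ht
      have := mul_nonneg hη0.le h3
      linarith
    · have h1 := hm t h
      rw [eval_sub, eval_C, hq] at h1
      linarith [(abs_lt.1 h1).1]

theorem hasDerivAt_euclidean_iff {f : ℝ → KnotEuclidean n} {f' : KnotEuclidean n} {t : ℝ} :
    HasDerivAt f f' t ↔ ∀ i, HasDerivAt (fun s => f s i) (f' i) t := by
  simp only [hasDerivAt_iff_hasFDerivAt, ← hasFDerivWithinAt_univ]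
  rw [hasFDerivWithinAt_euclidean]
  refine forall_congr' fun i => ?_
  rw [show (PiLp.proj 2 (fun _ : Fin n => ℝ) i).comp (ContinuousLinearMap.toSpanSingleton ℝ f') =
    ContinuousLinearMap.toSpanSingleton ℝ (f' i) by ext; simp]

theorem hasDerivAt_polyCurve (Q : Fin n → ℝ[X]) (t : ℝ) :
    HasDerivAt (polyCurve Q) (polyCurve (fun i => derivative (Q i)) t) t := by
  rw [hasDerivAt_euclidean_iff]
  exact fun i => (Q i).hasDerivAt t

theorem exists_hasDerivAt_polyCurve (Q : Fin n → ℝ[X]) :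
    ∃ P : Fin n → ℝ[X], ∀ t, HasDerivAt (polyCurve P) (polyCurve Q t) t := by
  choose P hP using fun i => exists_polynomial_derivative_eq (Q i)
  refine ⟨P, fun t => ?_⟩
  have := hasDerivAt_polyCurve P t
  rwa [show (fun i => derivative (P i)) = Q from funext hP] at this

theorem contDiff_polyCurve (Q : Fin n → ℝ[X]) : ContDiff ℝ ∞ (polyCurve Q) := by
  rw [contDiff_euclidean]
  exact fun i => Polynomial.contDiff_aeval (Q i) _

end Polynomial

/-! ### Long knots -/

section LongKnot

variable {n : ℕ}

/-- The projection of the real line onto `[-R, R]`. -/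
noncomputable def clamp (R t : ℝ) : ℝ := max (-R) (min t R)

/-- The curve which agrees with `P` on `[-R, R]` and continues linearly in direction `A`. -/
noncomputable def straighten (P : ℝ → KnotEuclidean n) (A : KnotEuclidean n) (R u : ℝ) :
    KnotEuclidean n :=
  P (clamp R u) + (u - clamp R u) • A

theorem clamp_of_ge {R t : ℝ} (hR : 0 ≤ R) (ht : R ≤ t) : clamp R t = R := by
  rw [clamp, min_eq_right ht, max_eq_right (by linarith)]

theorem clamp_of_le {R t : ℝ} (hR : 0 ≤ R) (ht : t ≤ -R) : clamp R t = -R := by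
  rw [clamp, min_eq_left (by linarith), max_eq_left ht]

theorem clamp_of_mem {R t : ℝ} (h₁ : -R ≤ t) (h₂ : t ≤ R) : clamp R t = t := by
  rw [clamp, min_eq_left h₂, max_eq_right h₁]

theorem clamp_mem {R : ℝ} (hR : 0 ≤ R) (t : ℝ) : clamp R t ∈ Set.Icc (-R) R :=
  ⟨le_max_left _ _, max_le (by linarith) (min_le_right _ _)⟩

theorem continuous_clamp (R : ℝ) : Continuous (clamp R) := by
  unfold clamp
  fun_prop

theorem clamp_mono (R : ℝ) : Monotone (clamp R) := fun _ _ h =>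
  max_le_max le_rfl (min_le_min h le_rfl)

theorem abs_clamp_sub_clamp_le (R s t : ℝ) : |clamp R s - clamp R t| ≤ |s - t| := by
  unfold clamp
  rw [max_comm, max_comm (-R)]
  exact (abs_max_sub_max_le_abs _ _ _).trans (abs_inf_sub_inf_le_abs _ _ _)

/-- A curve whose ends are graphs over an axis can be straightened at its ends by a
reparametrization and an orientation-preserving homeomorphism. -/
theorem exists_homeomorph_straighten {P : ℝ → KnotEuclidean n} (hP : Continuous P)
    (ℓ : KnotEuclidean n →L[ℝ] ℝ) {A : KnotEuclidean n} (hA : ℓ A = 1) {R : ℝ} (hR : 0 ≤ R)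
    (hmono₁ : StrictMonoOn (fun t => ℓ (P t)) (Set.Ici R))
    (hmono₂ : StrictMonoOn (fun t => ℓ (P t)) (Set.Iic (-R)))
    (htop : Tendsto (fun t => ℓ (P t)) atTop atTop)
    (hbot : Tendsto (fun t => ℓ (P t)) atBot atBot)
    (hslab : ∀ t ∈ Set.Icc (-R) R, ℓ (P (-R)) ≤ ℓ (P t) ∧ ℓ (P t) ≤ ℓ (P R)) :
    ∃ (θ : ℝ ≃ₜ ℝ) (h : KnotEuclidean n ≃ₜ KnotEuclidean n),
      Tendsto θ atTop atTop ∧ Tendsto θ atBot atBot ∧ OrientationPreserving (sphereHomeo h) ∧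
      ∀ t, P t = h (straighten P A R (θ t)) := by
  set w : ℝ → ℝ := fun t => ℓ (P t) with hw
  have hwc : Continuous w := by fun_prop
  have hcc := continuous_clamp R
  -- The parameter change is the identity on `[-R, R]` and measures the ends by their height `w = ℓ
  -- ∘ P`. As `ℓ A = 1`, the straightened curve at `f t` then has the same height as `P t`.
  set f : ℝ → ℝ := fun t =>
    clamp R t + (w (max t R) - w R) + (w (min t (-R)) - w (-R)) with hf
  have hfc : Continuous f := by fun_prop
  have f_ge : ∀ t, R ≤ t → f t = R + (w t - w R) := fun t ht => by
    simp only [hf]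
    rw [clamp_of_ge hR ht, max_eq_left ht, min_eq_right (by linarith)]
    ring
  have f_le : ∀ t, t ≤ -R → f t = -R + (w t - w (-R)) := fun t ht => by
    simp only [hf]
    rw [clamp_of_le hR ht, max_eq_right (by linarith), min_eq_left ht]
    ring
  have f_mem : ∀ t, -R ≤ t → t ≤ R → f t = t := fun t h₁ h₂ => by
    simp only [hf]
    rw [clamp_of_mem h₁ h₂, max_eq_right h₂, min_eq_right h₁]
    ring
  have hfs : StrictMono f := by
    intro s t hst
    have m₁ : clamp R s ≤ clamp R t := clamp_mono R hst.le
    have m₂ : w (max s R) ≤ w (max t R) :=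
      hmono₁.monotoneOn (le_max_right s R) (le_max_right t R) (max_le_max hst.le le_rfl)
    have m₃ : w (min s (-R)) ≤ w (min t (-R)) :=
      hmono₂.monotoneOn (min_le_right s (-R)) (min_le_right t (-R)) (min_le_min hst.le le_rfl)
    simp only [hf]
    rcases lt_or_ge R t with h₁ | h₁
    · have : w (max s R) < w (max t R) :=
        hmono₁ (le_max_right s R) (le_max_right t R)
          (by rw [max_eq_left h₁.le]; exact max_lt hst h₁)
      linarith
    rcases lt_or_ge s (-R) with h₂ | h₂
    · have : w (min s (-R)) < w (min t (-R)) :=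
        hmono₂ (min_le_right s (-R)) (min_le_right t (-R))
          (by rw [min_eq_left h₂.le]; exact lt_min hst h₂)
      linarith
    · have : clamp R s < clamp R t := by
        rwa [clamp_of_mem h₂ (by linarith), clamp_of_mem (by linarith) h₁]
      linarith
  have hft : Tendsto f atTop atTop := by
    refine (tendsto_atTop_add_const_left atTop (R - w R) htop).congr' ?_
    filter_upwards [eventually_ge_atTop R] with t ht
    rw [f_ge t ht]
    ring
  have hfb : Tendsto f atBot atBot := by
    refine (tendsto_atBot_add_const_left atBot (-R - w (-R)) hbot).congr' ?_
    filter_upwards [eventually_le_atBot (-R)] with t ht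
    rw [f_le t ht]
    ring
  have hsurj : Function.Surjective f := hfc.surjective hft hfb
  set θ : ℝ ≃ₜ ℝ := (hfs.orderIsoOfSurjective f hsurj).toHomeomorph with hθ
  have hθf : ∀ t, θ t = f t := fun t => rfl
  set D : ℝ → KnotEuclidean n := fun t => P t - straighten P A R (θ t) with hD
  have hDc : Continuous D := by
    simp only [hD, straighten]
    fun_prop
  have w_mono : ∀ t, R ≤ t → w R ≤ w t := fun t ht =>
    hmono₁.monotoneOn (Set.mem_Ici.2 le_rfl) ht ht
  have w_mono' : ∀ t, t ≤ -R → w t ≤ w (-R) := fun t ht =>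
    hmono₂.monotoneOn ht (Set.mem_Iic.2 le_rfl) ht
  have g_ge : ∀ t, R ≤ t → straighten P A R (θ t) = P R + (w t - w R) • A := fun t ht => by
    rw [straighten, hθf, f_ge t ht, clamp_of_ge hR (by linarith [w_mono t ht])]
    congr 2
    ring
  have g_le : ∀ t, t ≤ -R → straighten P A R (θ t) = P (-R) + (w t - w (-R)) • A :=
    fun t ht => by
      rw [straighten, hθf, f_le t ht, clamp_of_le hR (by linarith [w_mono' t ht])]
      congr 2
      ring
  have g_mem : ∀ t, -R ≤ t → t ≤ R → straighten P A R (θ t) = P t := fun t h₁ h₂ => by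
    rw [straighten, hθf, f_mem t h₁ h₂, clamp_of_mem h₁ h₂, sub_self, zero_smul, add_zero]
  have trichotomy : ∀ t : ℝ, R ≤ t ∨ t ≤ -R ∨ (-R ≤ t ∧ t ≤ R) := fun t => by
    rcases le_total R t with h | h
    · exact Or.inl h
    rcases le_total t (-R) with h' | h'
    · exact Or.inr (Or.inl h')
    · exact Or.inr (Or.inr ⟨h', h⟩)
  have hℓg : ∀ t, ℓ (straighten P A R (θ t)) = w t := fun t => by
    rcases trichotomy t with h | h | ⟨h, h'⟩
    · rw [g_ge t h, map_add, map_smul, hA]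
      simp [hw]
    · rw [g_le t h, map_add, map_smul, hA]
      simp [hw]
    · rw [g_mem t h h']
  have hℓD : ∀ t, ℓ (D t) = 0 := fun t => by
    simp only [hD, map_sub, hℓg, hw, sub_self]
  have hD0 : ∀ t, -R ≤ t → t ≤ R → D t = 0 := fun t h₁ h₂ => by
    simp only [hD, g_mem t h₁ h₂, sub_self]
  have hθR : θ.symm R = R := by
    rw [Homeomorph.symm_apply_eq, hθf, f_mem R (by linarith) le_rfl]
  have hθR' : θ.symm (-R) = -R := by
    rw [Homeomorph.symm_apply_eq, hθf, f_mem (-R) le_rfl (by linarith)]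
  -- On each end the height `z` determines the parameter, so the horizontal displacement `D` is a
  -- function of `z`. The truncations make `a` vanish for heights between `w (-R)` and `w R`; by
  -- `hslab` the middle of the curve lies there and is not moved.
  set a : ℝ → KnotEuclidean n := fun z =>
    D (θ.symm (R + max (z - w R) 0)) + D (θ.symm (-R + min (z - w (-R)) 0)) with ha
  have hac : Continuous a := by
    have := θ.symm.continuous
    fun_prop
  have hℓa : ∀ z, ℓ (a z) = 0 := fun z => by
    simp only [ha, map_add, hℓD, add_zero]
  have hDR : D R = 0 := hD0 R (by linarith) le_rfl
  have hDR' : D (-R) = 0 := hD0 (-R) le_rfl (by linarith)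
  have hRR : w (-R) ≤ w R := (hslab R ⟨by linarith, le_rfl⟩).1
  have haw : ∀ t, a (w t) = D t := fun t => by
    simp only [ha]
    rcases trichotomy t with h | h | ⟨h, h'⟩
    · have := w_mono t h
      rw [max_eq_left (by linarith), min_eq_right (by linarith), add_zero, hθR', hDR',
        add_zero, ← f_ge t h, ← hθf, Homeomorph.symm_apply_apply]
    · have := w_mono' t h
      rw [max_eq_right (by linarith), min_eq_left (by linarith), add_zero, hθR, hDR,
        zero_add, ← f_le t h, ← hθf, Homeomorph.symm_apply_apply]
    · have := hslab t ⟨h, h'⟩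
      rw [max_eq_right (by linarith [this.2]), min_eq_right (by linarith [this.1]), add_zero,
        add_zero, hθR, hθR', hDR, hDR', hD0 t h h', add_zero]
  refine ⟨θ, shear ℓ a hac hℓa, hft, hfb, orientationPreserving_shear ℓ a hac hℓa, fun t => ?_⟩
  change P t = straighten P A R (θ t) + a (ℓ (straighten P A R (θ t)))
  rw [hℓg, haw]
  simp [hD]

/-- The deviation from a `C¹` curve asymptotic to a line of its straightened approximation is
Lipschitz. -/
theorem norm_straighten_sub_sub_le {P β P' β' : ℝ → KnotEuclidean n}
    (hP : ∀ t, HasDerivAt P (P' t) t) (hβ : ∀ t, HasDerivAt β (β' t) t) {A : KnotEuclidean n}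
    {R ε : ℝ} (hR : 0 ≤ R) (h₁ : ∀ t, |t| ≤ R → ‖P' t - β' t‖ ≤ ε)
    (h₂ : ∀ t, R ≤ |t| → ‖β' t - A‖ ≤ ε) (s t : ℝ) :
    ‖(straighten P A R s - β s) - (straighten P A R t - β t)‖ ≤ 3 * ε * |s - t| := by
  have hε : 0 ≤ ε := (norm_nonneg _).trans (h₂ R (le_abs_self R))
  set e : ℝ → KnotEuclidean n := fun u => u • A - β u with he
  have hed : ∀ u, HasDerivAt e (A - β' u) u := fun u => by
    have := ((hasDerivAt_id u).smul_const A).sub (hβ u)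
    rw [one_smul] at this
    exact this
  -- Each summand is a function with derivative of norm at most `ε`, composed with a 1-Lipschitz
  -- truncation. Hence the factor `3`.
  have hsplit : ∀ u, straighten P A R u - β u = (P (clamp R u) - β (clamp R u)) +
      (e (max u R) - e R) + (e (min u (-R)) - e (-R)) := fun u => by
    simp only [straighten, he]
    rcases le_total R u with h | h
    · rw [clamp_of_ge hR h, max_eq_left h, min_eq_right (by linarith), sub_smul]
      abel
    rcases le_total u (-R) with h' | h'
    · rw [clamp_of_le hR h', max_eq_right h, min_eq_left h', sub_smul]
      abel
    · rw [clamp_of_mem h' h, max_eq_right h, min_eq_right h', sub_smul]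
      abel
  have b₁ : ‖(P (clamp R s) - β (clamp R s)) - (P (clamp R t) - β (clamp R t))‖ ≤
      ε * |s - t| := by
    refine ((convex_Icc (-R) R).norm_image_sub_le_of_norm_hasDerivWithin_le
      (f := fun u => P u - β u) (f' := fun u => P' u - β' u)
      (fun u _ => ((hP u).sub (hβ u)).hasDerivWithinAt)
      (fun u hu => h₁ u (abs_le.2 hu)) (clamp_mem hR t) (clamp_mem hR s)).trans ?_
    exact mul_le_mul_of_nonneg_left (abs_clamp_sub_clamp_le R s t) hε
  have b₂ : ‖e (max s R) - e (max t R)‖ ≤ ε * |s - t| := by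
    refine ((convex_Ici R).norm_image_sub_le_of_norm_hasDerivWithin_le (C := ε)
      (fun u _ => (hed u).hasDerivWithinAt)
      (fun u hu => ?_) (le_max_right t R) (le_max_right s R)).trans ?_
    · rw [norm_sub_rev]
      exact h₂ u (le_trans hu (le_abs_self u))
    · exact mul_le_mul_of_nonneg_left (abs_max_sub_max_le_abs _ _ _) hε
  have b₃ : ‖e (min s (-R)) - e (min t (-R))‖ ≤ ε * |s - t| := by
    refine ((convex_Iic (-R)).norm_image_sub_le_of_norm_hasDerivWithin_le (C := ε)
      (fun u _ => (hed u).hasDerivWithinAt)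
      (fun u hu => ?_) (min_le_right t (-R)) (min_le_right s (-R))).trans ?_
    · rw [norm_sub_rev]
      exact h₂ u (le_trans (le_neg.1 hu) (neg_le_abs u))
    · exact mul_le_mul_of_nonneg_left (abs_inf_sub_inf_le_abs _ _ _) hε
  rw [hsplit s, hsplit t]
  calc _ = ‖((P (clamp R s) - β (clamp R s)) - (P (clamp R t) - β (clamp R t))) +
        (e (max s R) - e (max t R)) + (e (min s (-R)) - e (min t (-R)))‖ := by
        congr 1
        abel
    _ ≤ _ := norm_add₃_le
    _ ≤ 3 * ε * |s - t| := by linarith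

/-- A function on the line whose derivative is bounded below by a positive constant outside a
compact interval takes its extreme values over a large interval at the end points. -/
theorem mem_Icc_of_deriv_bounds {w w' : ℝ → ℝ} (hw : ∀ t, HasDerivAt w (w' t) t)
    {R₀ R K : ℝ} (hR₀ : 0 ≤ R₀) (hK : 0 ≤ K) (hR : R₀ + 8 * R₀ * K ≤ R)
    (h₁ : ∀ t, |t| ≤ R₀ → -K ≤ w' t) (h₂ : ∀ t, R₀ ≤ |t| → 1 / 4 ≤ w' t)
    {t : ℝ} (ht : t ∈ Set.Icc (-R) R) : w (-R) ≤ w t ∧ w t ≤ w R := by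
  have hR' : R₀ ≤ R := by nlinarith
  have up : ∀ x y, R₀ ≤ x → x ≤ y → 1 / 4 * (y - x) ≤ w y - w x := fun x y hx hxy =>
    (convex_Ici R₀).mul_sub_le_image_sub_of_le_deriv
      (fun u _ => (hw u).continuousAt.continuousWithinAt)
      (fun u _ => (hw u).differentiableAt.differentiableWithinAt)
      (fun u hu => by
        rw [(hw u).deriv]
        exact h₂ u (le_trans (interior_subset hu) (le_abs_self u))) x hx y (hx.trans hxy) hxy
  have down : ∀ x y, y ≤ -R₀ → x ≤ y → 1 / 4 * (y - x) ≤ w y - w x := fun x y hy hxy =>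
    (convex_Iic (-R₀)).mul_sub_le_image_sub_of_le_deriv
      (fun u _ => (hw u).continuousAt.continuousWithinAt)
      (fun u _ => (hw u).differentiableAt.differentiableWithinAt)
      (fun u hu => by
        rw [(hw u).deriv]
        have : u ∈ Set.Iic (-R₀) := interior_subset hu
        rw [Set.mem_Iic] at this
        exact h₂ u (le_trans (by linarith) (neg_le_abs u))) x (hxy.trans hy) y hy hxy
  have mid : ∀ x y, -R₀ ≤ x → x ≤ y → y ≤ R₀ → -K * (y - x) ≤ w y - w x := fun x y hx hxy hy =>
    (convex_Icc (-R₀) R₀).mul_sub_le_image_sub_of_le_deriv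
      (fun u _ => (hw u).continuousAt.continuousWithinAt)
      (fun u _ => (hw u).differentiableAt.differentiableWithinAt)
      (fun u hu => by
        rw [(hw u).deriv]
        have hu' : u ∈ Set.Icc (-R₀) R₀ := interior_subset hu
        exact h₁ u (abs_le.2 hu')) x ⟨hx, hxy.trans hy⟩ y ⟨hx.trans hxy, hy⟩ hxy
  -- Over `[-R₀, R₀]` the function can drop by at most `2 * R₀ * K`. Each outer interval regains at
  -- least `(R - R₀) / 4`, which is no less; this is the origin of the `8` in `hR`.
  have d₁ := up R₀ R le_rfl hR'
  have d₂ := down (-R) (-R₀) le_rfl (by linarith)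
  have d₃ := mid (-R₀) R₀ le_rfl (by linarith) le_rfl
  rcases le_total R₀ t with h | h
  · have := up t R h ht.2
    have := up R₀ t le_rfl h
    constructor <;> nlinarith [ht.1, ht.2]
  rcases le_total t (-R₀) with h' | h'
  · have := down (-R) t h' ht.1
    have := down t (-R₀) le_rfl h'
    constructor <;> nlinarith [ht.1, ht.2]
  · have m₁ := mid (-R₀) t le_rfl h' h
    have m₂ := mid t R₀ h' h le_rfl
    have k₁ : K * (R₀ - t) ≤ K * (2 * R₀) := mul_le_mul_of_nonneg_left (by linarith) hK
    have k₂ : K * (t + R₀) ≤ K * (2 * R₀) := mul_le_mul_of_nonneg_left (by linarith) hK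
    constructor <;> nlinarith

theorem le_norm_of_hasDerivAt {β : ℝ → KnotEuclidean n} {c : ℝ}
    (hanti : ∀ s t, c * |s - t| ≤ ‖β s - β t‖) {b : KnotEuclidean n} {t : ℝ}
    (h : HasDerivAt β b t) : c ≤ ‖b‖ := by
  refine ge_of_tendsto (hasDerivAt_iff_tendsto_slope.1 h).norm ?_
  filter_upwards [self_mem_nhdsWithin] with y hy
  have hy' : 0 < |y - t| := abs_pos.2 (sub_ne_zero.2 hy)
  rw [slope_def_module, norm_smul, norm_inv, Real.norm_eq_abs, inv_mul_eq_div,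
    le_div_iff₀ hy']
  exact hanti y t

/-- Expansion gives injectivity and forces unbounded parameters to unbounded points, so the curve is
proper and therefore closed. -/
theorem isClosedEmbedding_of_le_norm_sub {β : ℝ → KnotEuclidean n} (hβ : Continuous β) {c : ℝ}
    (hc : 0 < c) (hanti : ∀ s t, c * |s - t| ≤ ‖β s - β t‖) :
    Topology.IsClosedEmbedding β := by
  have ha : AntilipschitzWith (Real.toNNReal c⁻¹) β := by
    refine AntilipschitzWith.of_le_mul_dist fun s t => ?_
    rw [Real.coe_toNNReal _ (by positivity), inv_mul_eq_div, le_div_iff₀ hc, dist_eq_norm,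
      dist_eq_norm, mul_comm]
    exact hanti s t
  have hp : IsProperMap β := by
    rw [isProperMap_iff_tendsto_cocompact]
    refine ⟨hβ, ?_⟩
    rw [← Metric.cobounded_eq_cocompact, ← Metric.cobounded_eq_cocompact]
    exact ha.tendsto_cobounded
  exact .of_continuous_injective_isClosedMap hβ ha.injective hp.isClosedMap

/-- A `C¹` expanding curve asymptotic to a line at both ends is carried to a polynomial knot by
an orientation-preserving homeomorphism and an increasing reparametrization. -/
theorem exists_polynomialKnot_of_asymptotic {β β' : ℝ → KnotEuclidean n}
    (hβ : ∀ t, HasDerivAt β (β' t) t) (hβ' : Continuous β') {A : KnotEuclidean n}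
    (hA : Tendsto β' (Bornology.cobounded ℝ) (𝓝 A)) {c : ℝ} (hc : 0 < c)
    (hanti : ∀ s t, c * |s - t| ≤ ‖β s - β t‖) :
    ∃ κ : ℝ → KnotEuclidean n, IsPolynomialKnot κ ∧
      ∃ (h : KnotEuclidean n ≃ₜ KnotEuclidean n) (θ : ℝ ≃ₜ ℝ),
        OrientationPreserving (sphereHomeo h) ∧ Tendsto θ atTop atTop ∧ Tendsto θ atBot atBot ∧
        ∀ t, κ t = h (β (θ t)) := by
  have hβc : Continuous β := continuous_iff_continuousAt.2 fun t => (hβ t).continuousAt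
  have hcβ' : ∀ t, c ≤ ‖β' t‖ := fun t => le_norm_of_hasDerivAt hanti (hβ t)
  have hcA : c ≤ ‖A‖ := ge_of_tendsto hA.norm (Eventually.of_forall hcβ')
  have hA0 : ‖A‖ ≠ 0 := (hc.trans_le hcA).ne'
  obtain ⟨g, -, hg⟩ := exists_dual_vector ℝ A hA0
  set ℓ : KnotEuclidean n →L[ℝ] ℝ := ‖A‖⁻¹ • g with hℓ
  have hℓA : ℓ A = 1 := by
    have : g A = ‖A‖ := by simpa using hg
    simp [hℓ, this, hA0]
  set Λ : ℝ := ↑(lipschitzExtensionConstant (KnotEuclidean n)) with hΛ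
  have hΛ0 : 0 < Λ := lipschitzExtensionConstant_pos _
  -- The three bounds serve, in order, the Lipschitz extension of a `3ε`-Lipschitz deviation, the
  -- nonvanishing of `Q` where it is close to `β'`, and the control of `ℓ` on the approximation
  -- error.
  set ε : ℝ := min (c / (6 * Λ)) (min (c / 2) (1 / (2 * (‖ℓ‖ + 1)))) with hε
  have hε0 : 0 < ε := by positivity
  have hε₁ : Λ * (3 * ε) ≤ c / 2 := by
    have : ε ≤ c / (6 * Λ) := min_le_left _ _
    rw [le_div_iff₀ (by positivity)] at this
    linarith
  have hε₂ : ε ≤ c / 2 := (min_le_right _ _).trans (min_le_left _ _)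
  have hε₃ : ‖ℓ‖ * ε ≤ 1 / 2 := by
    have : ε ≤ 1 / (2 * (‖ℓ‖ + 1)) := (min_le_right _ _).trans (min_le_right _ _)
    rw [le_div_iff₀ (by positivity)] at this
    nlinarith
  obtain ⟨R₀, hR₀, hAR₀⟩ : ∃ R₀ : ℝ, 0 ≤ R₀ ∧ ∀ t, R₀ ≤ |t| → ‖β' t - A‖ ≤ ε := by
    have h1 : ∀ᶠ t in Bornology.cobounded ℝ, ‖β' t - A‖ ≤ ε := by
      filter_upwards [hA (Metric.closedBall_mem_nhds A hε0)] with t ht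
      rwa [← dist_eq_norm]
    obtain ⟨r, -, hr⟩ := hasBasis_cobounded_norm.eventually_iff.1 h1
    exact ⟨max r 0, le_max_right _ _, fun t ht => hr ((le_max_left _ _).trans ht)⟩
  have hℓβ' : ∀ t, R₀ ≤ |t| → 1 / 2 ≤ ℓ (β' t) := fun t ht => by
    have h1 : ‖ℓ (β' t - A)‖ ≤ 1 / 2 :=
      ((ℓ.le_opNorm _).trans (mul_le_mul_of_nonneg_left (hAR₀ t ht) (norm_nonneg _))).trans hε₃
    rw [map_sub, hℓA] at h1
    linarith [(abs_le.1 h1).1]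
  obtain ⟨B, hB⟩ := (isCompact_Icc (a := -R₀) (b := R₀)).exists_bound_of_continuousOn
    hβ'.continuousOn
  have hB0 : 0 ≤ B := (norm_nonneg _).trans (hB 0 ⟨by linarith, hR₀⟩)
  -- This bounds `|ℓ (Q t)|` on `[-R₀, R₀]` for every `Q` that is `ε`-close to `β'`. So `R` can be
  -- fixed before `Q` is chosen, although `Q` depends on `R`.
  set K : ℝ := ‖ℓ‖ * (B + ε) with hK
  have hK0 : 0 ≤ K := by positivity
  set R : ℝ := R₀ + 8 * R₀ * K + 1 with hR
  have hRR₀ : R₀ ≤ R := by nlinarith [mul_nonneg hR₀ hK0]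
  have hR0 : 0 < R := by nlinarith [mul_nonneg hR₀ hK0]
  obtain ⟨Q, hQ₁, hQ₂⟩ := exists_polyCurve_near_of_pos hβ' ℓ hℓA hR0 hε0 hε₃ hℓβ'
  obtain ⟨P, hP⟩ := exists_hasDerivAt_polyCurve Q
  have hQ0 : ∀ t, polyCurve Q t ≠ 0 := fun t h0 => by
    rcases le_total |t| R with h | h
    · have := hQ₁ t h
      rw [h0, zero_sub, norm_neg] at this
      linarith [hcβ' t]
    · have := hQ₂ t (hRR₀.trans h)
      rw [h0, map_zero] at this
      norm_num at this
  have hPc : Continuous (polyCurve P) := (contDiff_polyCurve P).continuous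
  have hw : ∀ t, HasDerivAt (fun t => ℓ (polyCurve P t)) (ℓ (polyCurve Q t)) t := fun t =>
    ℓ.hasFDerivAt.comp_hasDerivAt t (hP t)
  have hup : ∀ s t, R ≤ s → s ≤ t →
      1 / 4 * (t - s) ≤ ℓ (polyCurve P t) - ℓ (polyCurve P s) := fun s t hs hst =>
    (convex_Ici R).mul_sub_le_image_sub_of_le_deriv (f := fun t => ℓ (polyCurve P t))
      (fun u _ => (hw u).continuousAt.continuousWithinAt)
      (fun u _ => (hw u).differentiableAt.differentiableWithinAt)
      (fun u hu => by
        rw [(hw u).deriv]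
        have hu' : u ∈ Set.Ici R := interior_subset hu
        exact hQ₂ u ((hRR₀.trans hu').trans (le_abs_self u))) s hs t (hs.trans hst) hst
  have hdown : ∀ s t, t ≤ -R → s ≤ t →
      1 / 4 * (t - s) ≤ ℓ (polyCurve P t) - ℓ (polyCurve P s) := fun s t ht hst =>
    (convex_Iic (-R)).mul_sub_le_image_sub_of_le_deriv (f := fun t => ℓ (polyCurve P t))
      (fun u _ => (hw u).continuousAt.continuousWithinAt)
      (fun u _ => (hw u).differentiableAt.differentiableWithinAt)
      (fun u hu => by
        rw [(hw u).deriv]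
        have hu' : u ∈ Set.Iic (-R) := interior_subset hu
        exact hQ₂ u ((hRR₀.trans (le_neg.1 hu')).trans (neg_le_abs u))) s (hst.trans ht) t ht hst
  have htop : Tendsto (fun t => ℓ (polyCurve P t)) atTop atTop := by
    refine tendsto_atTop_mono' atTop (f₁ := fun t => 1 / 4 * (t + -R) + ℓ (polyCurve P R)) ?_ ?_
    · filter_upwards [eventually_ge_atTop R] with t ht
      linarith [hup R t le_rfl ht]
    · exact tendsto_atTop_add_const_right _ _
        ((tendsto_atTop_add_const_right _ _ tendsto_id).const_mul_atTop (by norm_num))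
  have hbot : Tendsto (fun t => ℓ (polyCurve P t)) atBot atBot := by
    refine tendsto_atBot_mono' atBot (f₁ := fun t => 1 / 4 * (t + R) + ℓ (polyCurve P (-R))) ?_ ?_
    · filter_upwards [eventually_le_atBot (-R)] with t ht
      linarith [hdown t (-R) le_rfl ht]
    · exact tendsto_atBot_add_const_right _ _
        ((tendsto_atBot_add_const_right _ _ tendsto_id).const_mul_atBot (by norm_num))
  obtain ⟨θ, h₁, hθ₁, hθ₂, hop₁, hPh⟩ := exists_homeomorph_straighten hPc ℓ hℓA hR0.le
    (fun s hs t _ hst => by linarith [hup s t hs hst.le])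
    (fun s _ t ht hst => by linarith [hdown s t ht hst.le]) htop hbot
    (fun t ht => mem_Icc_of_deriv_bounds hw hR₀ hK0 (by linarith) (fun u hu => by
        have h1 : ‖polyCurve Q u‖ ≤ B + ε := by
          have := norm_add_le (β' u) (polyCurve Q u - β' u)
          rw [add_sub_cancel] at this
          linarith [hB u (abs_le.1 hu), hQ₁ u (hu.trans hRR₀)]
        have h2 : ‖ℓ (polyCurve Q u)‖ ≤ K :=
          (ℓ.le_opNorm _).trans (mul_le_mul_of_nonneg_left h1 (norm_nonneg _))
        exact (abs_le.1 h2).1) hQ₂ ht)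
  obtain ⟨h₂, hop₂, hβh⟩ := exists_homeomorph_of_lipschitz_perturbation hc hanti
    (norm_straighten_sub_sub_le hP hβ hR0.le hQ₁ fun t ht => hAR₀ t (hRR₀.trans ht)) hε₁
  have hκ : ∀ t, polyCurve P t = (h₂.trans h₁) (β (θ t)) := fun t => by
    rw [Homeomorph.trans_apply, hβh, add_sub_cancel, ← hPh]
  refine ⟨polyCurve P, ⟨⟨P, fun t i => rfl⟩, (contDiff_polyCurve P).contMDiff, fun t => ?_, ?_⟩,
    h₂.trans h₁, θ, ?_, hθ₁, hθ₂, hκ⟩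
  · rw [mfderiv_eq_fderiv, (hP t).hasFDerivAt.fderiv]
    exact smul_left_injective ℝ (hQ0 t)
  · have : polyCurve P = (h₂.trans h₁) ∘ β ∘ θ := funext hκ
    rw [this]
    exact (h₂.trans h₁).isEmbedding.comp
      ((isClosedEmbedding_of_le_norm_sub hβc hc hanti).isEmbedding.comp θ.isEmbedding)
  · rw [sphereHomeo_trans]
    exact hop₂.trans hop₁

end LongKnot

/-! ### Regular curves on the circle -/

theorem contMDiff_coe_knotSphere (n : ℕ) {m : WithTop ℕ∞} :
    ContMDiff (𝓡 n) 𝓘(ℝ, KnotEuclidean (n + 1)) m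
      (Subtype.val : KnotSphere n → KnotEuclidean (n + 1)) :=
  have := Fact.mk (finrank_euclideanSpace_fin (𝕜 := ℝ) (n := n + 1))
  contMDiff_coe_sphere

theorem mfderiv_coe_knotSphere_injective (n : ℕ) (p : KnotSphere n) :
    Function.Injective (mfderiv (𝓡 n) 𝓘(ℝ, KnotEuclidean (n + 1))
      (Subtype.val : KnotSphere n → KnotEuclidean (n + 1)) p) := by
  have := Fact.mk (finrank_euclideanSpace_fin (𝕜 := ℝ) (n := n + 1))
  exact injective_mvfderiv_subtypeVal_sphere p

theorem contMDiff_codRestrict_knotSphere {n : ℕ} {m : WithTop ℕ∞} {f : ℝ → KnotEuclidean (n + 1)}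
    (hf : ContDiff ℝ m f) (hmem : ∀ x, f x ∈ Metric.sphere (0 : KnotEuclidean (n + 1)) 1) :
    ContMDiff 𝓘(ℝ, ℝ) (𝓡 n) m (fun x => (⟨f x, hmem x⟩ : KnotSphere n)) :=
  have := Fact.mk (finrank_euclideanSpace_fin (𝕜 := ℝ) (n := n + 1))
  hf.contMDiff.codRestrict_sphere hmem

/-- Coordinates of the rational parametrization of the circle based at `(p, q)`. -/
noncomputable def circleCoords (p q s : ℝ) : KnotEuclidean 2 :=
  !₂[(p * (1 - s ^ 2) + 2 * s * q) / (1 + s ^ 2), (q * (1 - s ^ 2) - 2 * s * p) / (1 + s ^ 2)]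

theorem circle_sq_add_sq (P : KnotSphere 1) : P.1 0 ^ 2 + P.1 1 ^ 2 = 1 := by
  have h := EuclideanSpace.real_norm_sq_eq P.1
  rw [mem_sphere_zero_iff_norm.1 P.2, Fin.sum_univ_two] at h
  linarith

theorem mem_circle_of_sq_add_sq {x : KnotEuclidean 2} (h : x 0 ^ 2 + x 1 ^ 2 = 1) :
    x ∈ Metric.sphere (0 : KnotEuclidean (1 + 1)) 1 := by
  rw [mem_sphere_zero_iff_norm]
  refine (sq_eq_sq₀ (norm_nonneg _) zero_le_one).1 ?_
  rw [EuclideanSpace.real_norm_sq_eq, Fin.sum_univ_two]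
  linarith

/-- The rational parametrization of the circle, based at a point `P`, of the complement of the
antipode of `P`. -/
noncomputable def circleCurve (P : KnotSphere 1) (s : ℝ) : KnotSphere 1 :=
  ⟨circleCoords (P.1 0) (P.1 1) s, mem_circle_of_sq_add_sq (by
    have h := circle_sq_add_sq P
    have h0 : 1 + s ^ 2 ≠ 0 := by positivity
    simp only [circleCoords, Matrix.cons_val_zero, Matrix.cons_val_one, PiLp.toLp_apply]
    field_simp
    linear_combination (1 + s ^ 2) ^ 2 * h)⟩

theorem circleCurve_zero (P : KnotSphere 1) : circleCurve P 0 = P := by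
  apply Subtype.ext
  ext i
  fin_cases i <;> simp [circleCurve, circleCoords]

theorem contDiff_circleCoords (p q : ℝ) {m : WithTop ℕ∞} : ContDiff ℝ m (circleCoords p q) := by
  have h0 : ∀ s : ℝ, 1 + s ^ 2 ≠ 0 := fun s => by positivity
  rw [contDiff_euclidean]
  intro i
  fin_cases i
  · exact ContDiff.div (by fun_prop) (by fun_prop) h0
  · exact ContDiff.div (by fun_prop) (by fun_prop) h0

theorem contMDiff_circleCurve (P : KnotSphere 1) {m : WithTop ℕ∞} :
    ContMDiff 𝓘(ℝ, ℝ) (𝓡 1) m (circleCurve P) :=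
  contMDiff_codRestrict_knotSphere (contDiff_circleCoords _ _) _

theorem hasDerivAt_circleCoords_zero (p q : ℝ) :
    HasDerivAt (circleCoords p q) (!₂[2 * q, 2 * -p]) 0 := by
  have key : ∀ a b : ℝ,
      HasDerivAt (fun s : ℝ => (a * (1 - s ^ 2) + 2 * s * b) / (1 + s ^ 2)) (2 * b) 0 := by
    intro a b
    have h1 : HasDerivAt (fun s : ℝ => s ^ 2) 0 0 := by
      simpa using hasDerivAt_pow 2 (0 : ℝ)
    have h2 : HasDerivAt (fun s : ℝ => a * (1 - s ^ 2) + 2 * s * b) (a * (0 - 0) + 2 * 1 * b) 0 :=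
      (((hasDerivAt_const 0 1).sub h1).const_mul a).add
        (((hasDerivAt_id (0 : ℝ)).const_mul 2).mul_const b)
    have h3 : HasDerivAt (fun s : ℝ => 1 + s ^ 2) (0 + 0) 0 := (hasDerivAt_const 0 1).add h1
    exact (h2.div h3 (by norm_num)).congr_deriv (by norm_num)
  rw [hasDerivAt_euclidean_iff]
  intro i
  fin_cases i
  · exact key p q
  · have h := key q (-p)
    have e : (fun s : ℝ => (q * (1 - s ^ 2) + 2 * s * -p) / (1 + s ^ 2)) =
        fun s : ℝ => (q * (1 - s ^ 2) - 2 * s * p) / (1 + s ^ 2) := by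
      funext s
      ring
    rw [e] at h
    exact h

/-- The local inverse of `circleCurve P`. -/
noncomputable def circleCoord (P Q : KnotSphere 1) : ℝ :=
  (Q.1 0 * P.1 1 - Q.1 1 * P.1 0) / (1 + (Q.1 0 * P.1 0 + Q.1 1 * P.1 1))

theorem circleCurve_circleCoord {P Q : KnotSphere 1}
    (h : 1 + (Q.1 0 * P.1 0 + Q.1 1 * P.1 1) ≠ 0) : circleCurve P (circleCoord P Q) = Q := by
  have hP := circle_sq_add_sq P
  have hQ := circle_sq_add_sq Q
  set a := Q.1 0 * P.1 0 + Q.1 1 * P.1 1 with ha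
  set b := Q.1 0 * P.1 1 - Q.1 1 * P.1 0 with hb
  have hab : a ^ 2 + b ^ 2 = 1 := by
    rw [ha, hb]
    linear_combination (Q.1 0 ^ 2 + Q.1 1 ^ 2) * hP + hQ
  have hs : circleCoord P Q = b / (1 + a) := rfl
  have h1 : 1 + (b / (1 + a)) ^ 2 = 2 / (1 + a) := by
    field_simp
    linear_combination hab
  have h2 : 1 - (b / (1 + a)) ^ 2 = 2 * a / (1 + a) := by
    field_simp
    linear_combination -hab
  apply Subtype.ext
  ext i
  fin_cases i
  · simp only [circleCurve, circleCoords, hs, h1, h2]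
    simp only [Fin.zero_eta, Matrix.cons_val_zero]
    field_simp
    rw [ha, hb]
    linear_combination Q.1 0 * hP
  · simp only [circleCurve, circleCoords, hs, h1, h2]
    simp only [Fin.mk_one, Matrix.cons_val_one]
    field_simp
    rw [ha, hb]
    simp only [Matrix.cons_val_fin_one]
    linear_combination Q.1 1 * hP

theorem eventually_circleCoord (P : KnotSphere 1) :
    ∀ᶠ Q in 𝓝 P, 1 ≤ 1 + (Q.1 0 * P.1 0 + Q.1 1 * P.1 1) := by
  have hc : Continuous fun Q : KnotSphere 1 => Q.1 0 * P.1 0 + Q.1 1 * P.1 1 := by fun_prop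
  have h1 : 0 < P.1 0 * P.1 0 + P.1 1 * P.1 1 := by
    nlinarith [circle_sq_add_sq P]
  filter_upwards [continuousAt_const.eventually_lt hc.continuousAt h1] with Q hQ
  linarith

theorem circleCoord_self (P : KnotSphere 1) : circleCoord P P = 0 := by
  simp [circleCoord, mul_comm]

theorem tendsto_circleCoord (P : KnotSphere 1) : Tendsto (circleCoord P) (𝓝 P) (𝓝 0) := by
  rw [← circleCoord_self P]
  refine ContinuousAt.div (by fun_prop) (by fun_prop) ?_
  nlinarith [circle_sq_add_sq P]

/-- A map on the circle that is `C¹` with nonvanishing derivative, expressed in the rational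
parametrizations. -/
def IsRegularOnCircle {F : Type*} [NormedAddCommGroup F] [NormedSpace ℝ F]
    (φ : KnotSphere 1 → F) : Prop :=
  ∀ P, ContDiff ℝ 1 (fun s => φ (circleCurve P s)) ∧ deriv (fun s => φ (circleCurve P s)) 0 ≠ 0

/-- The velocity of `circleCurve P` at `0` is nonzero, because in the plane it is `(2q, -2p)` with
`p² + q² = 1`. An injective differential cannot kill it. -/
theorem IsRegularOnCircle.of_contMDiff {F : Type*} [NormedAddCommGroup F] [NormedSpace ℝ F]
    {φ : KnotSphere 1 → F} (hφ : ContMDiff (𝓡 1) 𝓘(ℝ, F) 1 φ)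
    (hinj : ∀ p, Function.Injective (mfderiv (𝓡 1) 𝓘(ℝ, F) φ p)) : IsRegularOnCircle φ := by
  intro P
  have hc := contMDiff_circleCurve P (m := 1)
  refine ⟨(hφ.comp hc).contDiff, fun h0 => ?_⟩
  have hcd : MDifferentiableAt 𝓘(ℝ, ℝ) (𝓡 1) (circleCurve P) 0 :=
    hc.mdifferentiableAt one_ne_zero
  have h1 := mfderiv_comp (I := 𝓘(ℝ, ℝ)) (I' := 𝓡 1) (I'' := 𝓘(ℝ, F)) (0 : ℝ)
    (hφ.mdifferentiableAt one_ne_zero) hcd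
  have h2 := mfderiv_comp (I := 𝓘(ℝ, ℝ)) (I' := 𝓡 1) (I'' := 𝓘(ℝ, KnotEuclidean 2)) (0 : ℝ)
    ((contMDiff_coe_knotSphere 1 (m := 1)).mdifferentiableAt one_ne_zero) hcd
  rw [mfderiv_eq_fderiv] at h1 h2
  have h3 : mfderiv (𝓡 1) 𝓘(ℝ, F) φ (circleCurve P 0)
      (mfderiv 𝓘(ℝ, ℝ) (𝓡 1) (circleCurve P) 0 (1 : ℝ)) = 0 := by
    have := congrArg (fun L => L (1 : ℝ)) h1
    exact this.symm.trans h0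
  have h4 : mfderiv 𝓘(ℝ, ℝ) (𝓡 1) (circleCurve P) 0 (1 : ℝ) = 0 :=
    hinj _ (h3.trans (map_zero _).symm)
  have h5 : deriv (circleCoords (P.1 0) (P.1 1)) 0 = 0 := by
    have := congrArg (fun L => L (1 : ℝ)) h2
    refine this.trans ?_
    change mfderiv (𝓡 1) 𝓘(ℝ, KnotEuclidean 2) _ (circleCurve P 0)
      (mfderiv 𝓘(ℝ, ℝ) (𝓡 1) (circleCurve P) 0 (1 : ℝ)) = 0
    rw [h4]
    exact map_zero _
  rw [(hasDerivAt_circleCoords_zero _ _).deriv] at h5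
  have e0 : 2 * P.1 1 = 0 := by simpa using congrArg (fun x : KnotEuclidean 2 => x 0) h5
  have e1 : P.1 0 = 0 := by simpa using congrArg (fun x : KnotEuclidean 2 => x 1) h5
  have := circle_sq_add_sq P
  rw [e1, show P.1 1 = 0 by linarith] at this
  norm_num at this

/-! ### From knots in the sphere to long knots -/

/-- By compactness finitely many of the local constants suffice, and their minimum works everywhere.
-/
theorem exists_pos_forall_mul_le {X : Type*} [TopologicalSpace X] [CompactSpace X] {f g : X → ℝ}
    (hf : ∀ x, 0 ≤ f x) (h : ∀ x, ∃ c > 0, ∀ᶠ y in 𝓝 x, c * f y ≤ g y) :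
    ∃ c > 0, ∀ x, c * f x ≤ g x := by
  have := isCompact_univ.induction_on (p := fun s : Set X => ∃ c > 0, ∀ x ∈ s, c * f x ≤ g x)
    ⟨1, one_pos, fun x hx => hx.elim⟩
    (fun s t hst ⟨c, hc, hct⟩ => ⟨c, hc, fun x hx => hct x (hst hx)⟩)
    (fun s t ⟨c, hc, hcs⟩ ⟨d, hd, hdt⟩ => ⟨min c d, lt_min hc hd, fun x hx => by
      rcases hx with hx | hx
      · exact (mul_le_mul_of_nonneg_right (min_le_left _ _) (hf x)).trans (hcs x hx)
      · exact (mul_le_mul_of_nonneg_right (min_le_right _ _) (hf x)).trans (hdt x hx)⟩)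
    (fun x _ => by
      obtain ⟨c, hc, hx⟩ := h x
      exact ⟨_, mem_nhdsWithin_of_mem_nhds hx, c, hc, fun y hy => hy⟩)
  obtain ⟨c, hc, hx⟩ := this
  exact ⟨c, hc, fun x => hx x (Set.mem_univ x)⟩

theorem HasStrictDerivAt.eventually_norm_sub_le {F : Type*} [NormedAddCommGroup F]
    [NormedSpace ℝ F] {f : ℝ → F} {f' : F} {x ε : ℝ} (h : HasStrictDerivAt f f' x) (hε : 0 < ε) :
    ∀ᶠ p : ℝ × ℝ in 𝓝 (x, x), ‖f p.1 - f p.2 - (p.1 - p.2) • f'‖ ≤ ε * |p.1 - p.2| := by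
  have := (hasStrictFDerivAt_iff_isLittleO.1 h.hasStrictFDerivAt).def hε
  simpa using this

/-! ### Chordal distance bounds for regular curves. -/

section Bilipschitz

theorem eventually_circleCurve_circleCoord (P : KnotSphere 1) :
    ∀ᶠ Q in 𝓝 P, circleCurve P (circleCoord P Q) = Q :=
  (eventually_circleCoord P).mono fun _ hQ => circleCurve_circleCoord (by linarith)

variable {F : Type*} [NormedAddCommGroup F] [NormedSpace ℝ F] {φ : KnotSphere 1 → F}

/-- A regular injective map on the circle is expanding. -/
theorem IsRegularOnCircle.exists_le_norm_sub (h : IsRegularOnCircle φ) (hφ : Continuous φ)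
    (hinj : Function.Injective φ) :
    ∃ c > 0, ∀ P Q : KnotSphere 1, c * ‖P.1 - Q.1‖ ≤ ‖φ P - φ Q‖ := by
  obtain ⟨c, hc, H⟩ := exists_pos_forall_mul_le (X := KnotSphere 1 × KnotSphere 1)
    (f := fun x => ‖x.1.1 - x.2.1‖) (g := fun x => ‖φ x.1 - φ x.2‖) (fun x => norm_nonneg _) (by
    rintro ⟨P, Q⟩
    by_cases hPQ : P = Q
    · subst hPQ
      obtain ⟨h1, h2⟩ := h P
      set d := deriv (fun s => φ (circleCurve P s)) 0 with hd
      have hd0 : 0 < ‖d‖ := norm_pos_iff.2 h2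
      have s1 : HasStrictDerivAt (fun s => φ (circleCurve P s)) d 0 :=
        h1.contDiffAt.hasStrictDerivAt one_ne_zero
      have s2 := (contDiff_circleCoords (P.1 0) (P.1 1) (m := 1)).contDiffAt.hasStrictDerivAt
        (x := 0) one_ne_zero
      set e := deriv (circleCoords (P.1 0) (P.1 1)) 0
      have ht : Tendsto (fun x : KnotSphere 1 × KnotSphere 1 =>
          (circleCoord P x.1, circleCoord P x.2)) (𝓝 (P, P)) (𝓝 (0, 0)) := by
        rw [nhds_prod_eq, nhds_prod_eq]
        exact (tendsto_circleCoord P).prodMap (tendsto_circleCoord P)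
      have i1 : ∀ᶠ x : KnotSphere 1 × KnotSphere 1 in 𝓝 (P, P),
          circleCurve P (circleCoord P x.1) = x.1 :=
        (eventually_circleCurve_circleCoord P).prod_inl_nhds P
      have i2 : ∀ᶠ x : KnotSphere 1 × KnotSphere 1 in 𝓝 (P, P),
          circleCurve P (circleCoord P x.2) = x.2 :=
        (eventually_circleCurve_circleCoord P).prod_inr_nhds P
      -- Near the diagonal, strict differentiability compares both distances with the parameter
      -- difference `r`: the image moves by at least `‖d‖ / 2 * |r|`, the point on the circle by at
      -- most `(‖e‖ + 1) * |r|`.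
      refine ⟨‖d‖ / 2 / (‖e‖ + 1), by positivity, ?_⟩
      filter_upwards [ht.eventually (s1.eventually_norm_sub_le (half_pos hd0)),
        ht.eventually (s2.eventually_norm_sub_le one_pos), i1, i2] with x k1 k2 e1 e2
      have e1' : circleCoords (P.1 0) (P.1 1) (circleCoord P x.1) = x.1.1 :=
        congrArg Subtype.val e1
      have e2' : circleCoords (P.1 0) (P.1 1) (circleCoord P x.2) = x.2.1 :=
        congrArg Subtype.val e2
      simp only [e1, e2, e1', e2'] at k1 k2
      set r := circleCoord P x.1 - circleCoord P x.2
      have n1 : ‖x.1.1 - x.2.1‖ ≤ (‖e‖ + 1) * |r| := by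
        have := norm_add_le (x.1.1 - x.2.1 - r • e) (r • e)
        rw [sub_add_cancel, norm_smul, Real.norm_eq_abs] at this
        linarith
      have n2 : ‖d‖ / 2 * |r| ≤ ‖φ x.1 - φ x.2‖ := by
        have := norm_sub_le (φ x.1 - φ x.2) (φ x.1 - φ x.2 - r • d)
        rw [sub_sub_cancel, norm_smul, Real.norm_eq_abs] at this
        linarith
      rw [div_mul_eq_mul_div, div_le_iff₀ (by positivity)]
      nlinarith [norm_nonneg e]
    · have hne : 0 < ‖φ P - φ Q‖ := norm_pos_iff.2 (sub_ne_zero.2 fun h => hPQ (hinj h))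
      -- Off the diagonal nearby image distances exceed half of `‖φ P - φ Q‖`, and chords of the
      -- circle have length at most `2`.
      refine ⟨‖φ P - φ Q‖ / 4, by positivity, ?_⟩
      have hc : Continuous fun x : KnotSphere 1 × KnotSphere 1 => ‖φ x.1 - φ x.2‖ := by fun_prop
      filter_upwards [continuousAt_const.eventually_lt hc.continuousAt
        (half_lt_self hne : ‖φ P - φ Q‖ / 2 < ‖φ P - φ Q‖)] with x hx
      have h2 : ‖x.1.1 - x.2.1‖ ≤ 2 := by
        have := norm_sub_le x.1.1 x.2.1
        rw [mem_sphere_zero_iff_norm.1 x.1.2, mem_sphere_zero_iff_norm.1 x.2.2] at this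
        linarith
      nlinarith)
  exact ⟨c, hc, fun P Q => H (P, Q)⟩

/-- A regular map on the circle is Lipschitz at each point. -/
theorem IsRegularOnCircle.exists_norm_sub_le (h : IsRegularOnCircle φ) (hφ : Continuous φ)
    (P : KnotSphere 1) :
    ∃ c > 0, ∀ Q : KnotSphere 1, c * ‖φ Q - φ P‖ ≤ ‖Q.1 - P.1‖ := by
  refine exists_pos_forall_mul_le (fun x => norm_nonneg _) fun Q => ?_
  by_cases hPQ : Q = P
  · subst hPQ
    obtain ⟨h1, -⟩ := h Q
    set d := deriv (fun s => φ (circleCurve Q s)) 0 with hd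
    have s1 : HasStrictDerivAt (fun s => φ (circleCurve Q s)) d 0 :=
      h1.contDiffAt.hasStrictDerivAt one_ne_zero
    have ht : Tendsto (fun x : KnotSphere 1 => (circleCoord Q x, (0 : ℝ))) (𝓝 Q) (𝓝 (0, 0)) :=
      (tendsto_circleCoord Q).prodMk_nhds tendsto_const_nhds
    refine ⟨1 / (2 * (‖d‖ + 1)), by positivity, ?_⟩
    filter_upwards [ht.eventually (s1.eventually_norm_sub_le one_pos),
      eventually_circleCoord Q, eventually_circleCurve_circleCoord Q] with x k1 k2 k3
    simp only [k3, circleCurve_zero, sub_zero] at k1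
    have b0 : |x.1 0 - Q.1 0| ≤ ‖x.1 - Q.1‖ := PiLp.norm_apply_le (x.1 - Q.1) 0
    have b1 : |x.1 1 - Q.1 1| ≤ ‖x.1 - Q.1‖ := PiLp.norm_apply_le (x.1 - Q.1) 1
    have hQ := circle_sq_add_sq Q
    have q0 : |Q.1 0| ≤ 1 := by
      rw [← sq_le_one_iff_abs_le_one]
      nlinarith [sq_nonneg (Q.1 1)]
    have q1 : |Q.1 1| ≤ 1 := by
      rw [← sq_le_one_iff_abs_le_one]
      nlinarith [sq_nonneg (Q.1 0)]
    have hs : |circleCoord Q x| ≤ 2 * ‖x.1 - Q.1‖ := by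
      rw [circleCoord, abs_div, abs_of_pos (show (0 : ℝ) < 1 + _ by linarith)]
      refine (div_le_self (abs_nonneg _) k2).trans ?_
      have : x.1 0 * Q.1 1 - x.1 1 * Q.1 0 =
          (x.1 0 - Q.1 0) * Q.1 1 - (x.1 1 - Q.1 1) * Q.1 0 := by ring
      rw [this]
      refine (abs_sub _ _).trans ?_
      rw [abs_mul, abs_mul]
      have m0 := mul_le_mul b0 q1 (abs_nonneg _) (norm_nonneg _)
      have m1 := mul_le_mul b1 q0 (abs_nonneg _) (norm_nonneg _)
      linarith
    have n1 : ‖φ x - φ Q‖ ≤ (‖d‖ + 1) * |circleCoord Q x| := by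
      have := norm_add_le (φ x - φ Q - circleCoord Q x • d) (circleCoord Q x • d)
      rw [sub_add_cancel, norm_smul, Real.norm_eq_abs] at this
      linarith
    rw [div_mul_eq_mul_div, div_le_iff₀ (by positivity)]
    nlinarith [norm_nonneg d]
  · have hne : 0 < ‖Q.1 - P.1‖ :=
      norm_pos_iff.2 (sub_ne_zero.2 fun h => hPQ (Subtype.ext h))
    refine ⟨‖Q.1 - P.1‖ / 2 / (‖φ Q - φ P‖ + 1), by positivity, ?_⟩
    have hc1 : Continuous fun x : KnotSphere 1 => ‖x.1 - P.1‖ := by fun_prop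
    have hc2 : Continuous fun x : KnotSphere 1 => ‖φ x - φ P‖ := by fun_prop
    filter_upwards [continuousAt_const.eventually_lt hc1.continuousAt
      (half_lt_self hne : ‖Q.1 - P.1‖ / 2 < ‖Q.1 - P.1‖),
      hc2.continuousAt.eventually_lt continuousAt_const
      (lt_add_one ‖φ Q - φ P‖ : ‖φ Q - φ P‖ < ‖φ Q - φ P‖ + 1)] with x h1 h2
    rw [div_mul_eq_mul_div, div_le_iff₀ (by positivity)]
    exact mul_le_mul h1.le h2.le (norm_nonneg _) (norm_nonneg _)

end Bilipschitz

/-! ### Velocity at infinity of the projected curve. -/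

section Asymptotics

variable {n : ℕ}

/-- The stereographic projection of a `C¹` curve on the sphere passing regularly through the north
pole has a velocity with a limit at infinity. -/
theorem exists_tendsto_deriv_stereoProj {y : ℝ → KnotEuclidean (n + 1)} (hy : ContDiff ℝ 1 y)
    (hnorm : ∀ s, ‖y s‖ = 1) (hy0 : y 0 = northPole n) (hne : ∀ s, s ≠ 0 → y s (Fin.last n) ≠ 1)
    (hd : deriv y 0 ≠ 0) :
    ∃ A : KnotEuclidean n,
      Tendsto (deriv fun t : ℝ => stereoProj (y t⁻¹)) (Bornology.cobounded ℝ) (𝓝 A) := by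
  set y' := deriv y with hy'
  have hder : ∀ s, HasDerivAt y (y' s) s := fun s =>
    (hy.differentiable one_ne_zero s).hasDerivAt
  have hy'c : Continuous y' := hy.continuous_deriv le_rfl
  have hyc : Continuous y := hy.continuous
  have hderi : ∀ s i, HasDerivAt (fun s => y s i) (y' s i) s := fun s =>
    hasDerivAt_euclidean_iff.1 (hder s)
  set u : Fin n → ℝ → ℝ := fun i s => y s i.castSucc with hu
  set u' : Fin n → ℝ → ℝ := fun i s => y' s i.castSucc with hu'
  set v : ℝ → ℝ := fun s => 1 - y s (Fin.last n) with hv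
  set v' : ℝ → ℝ := fun s => -y' s (Fin.last n) with hv'
  have hud : ∀ i s, HasDerivAt (u i) (u' i s) s := fun i s => hderi s _
  have hvd : ∀ s, HasDerivAt v (v' s) s := fun s => (hderi s (Fin.last n)).const_sub 1
  -- The curve is only `C¹`, so Taylor expansion does not give the quadratic behaviour of `v` at
  -- `0`. The sphere equation and its derivative do: they yield the limits of `v / s²` and `v' / s`
  -- from those of `u / s` and `u'`.
  have hsum : ∀ s, ∑ i, u i s ^ 2 = 2 * v s - v s ^ 2 := fun s => by
    have := EuclideanSpace.real_norm_sq_eq (y s)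
    rw [hnorm, Fin.sum_univ_castSucc] at this
    simp only [hu, hv]
    linarith
  have hsum' : ∀ s, ∑ i, u i s * u' i s = (1 - v s) * v' s := fun s => by
    have h1 : HasDerivAt (fun s => ∑ i, u i s ^ 2) (∑ i, 2 * (u i s * u' i s)) s :=
      HasDerivAt.fun_sum fun i _ => ((hud i s).pow 2).congr_deriv (by push_cast; ring)
    have h2 : HasDerivAt (fun s => 2 * v s - v s ^ 2) (2 * v' s - 2 * v s * v' s) s :=
      (((hvd s).const_mul 2).sub ((hvd s).pow 2)).congr_deriv (by push_cast; ring)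
    rw [funext hsum] at h1
    have h3 := h1.unique h2
    rw [← Finset.mul_sum] at h3
    linarith
  have hu0 : ∀ i, u i 0 = 0 := fun i => by
    simp only [hu, hy0, northPole]
    simp
  have hv0 : v 0 = 0 := by
    simp only [hv, hy0, northPole]
    simp
  have hv'0 : v' 0 = 0 := by
    have := hsum' 0
    simp only [hu0, hv0, zero_mul, Finset.sum_const_zero, sub_zero, one_mul] at this
    exact this.symm
  set a : Fin n → ℝ := fun i => u' i 0 with ha
  set q : ℝ := (∑ i, a i ^ 2) / 2 with hq
  -- As `v' 0 = 0`, the nonzero velocity at the pole is entirely horizontal.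
  have hq0 : q ≠ 0 := by
    intro h0
    have h1 : ∑ i, a i ^ 2 = 0 := by
      rw [hq] at h0
      linarith
    have h2 := (Finset.sum_eq_zero_iff_of_nonneg fun i _ => sq_nonneg (a i)).1 h1
    apply hd
    ext i
    refine Fin.lastCases ?_ (fun j => ?_) i
    · have : -y' 0 (Fin.last n) = 0 := hv'0
      simpa using this
    · have := h2 j (Finset.mem_univ j)
      simpa [ha, hu'] using this
  have tu : ∀ i, Tendsto (fun s => u i s / s) (𝓝[≠] 0) (𝓝 (a i)) := fun i => by
    have := hasDerivAt_iff_tendsto_slope.1 (hud i 0)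
    refine this.congr fun s => ?_
    rw [slope_def_field, hu0, sub_zero, sub_zero]
  have tu' : ∀ i, Tendsto (u' i) (𝓝[≠] 0) (𝓝 (a i)) := fun i =>
    ((show Continuous (u' i) by fun_prop).tendsto 0).mono_left nhdsWithin_le_nhds
  have tv : Tendsto v (𝓝[≠] 0) (𝓝 0) := by
    have := (show Continuous v by fun_prop).tendsto 0
    rw [hv0] at this
    exact this.mono_left nhdsWithin_le_nhds
  have hsmall : ∀ᶠ s in 𝓝[≠] (0 : ℝ), v s < 1 := tv.eventually_lt_const one_pos
  have tv2 : Tendsto (fun s => v s / s ^ 2) (𝓝[≠] 0) (𝓝 q) := by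
    have h1 : Tendsto (fun s => (∑ i, (u i s / s) ^ 2) / (2 - v s)) (𝓝[≠] 0)
        (𝓝 ((∑ i, a i ^ 2) / (2 - 0))) :=
      (tendsto_finsetSum _ fun i _ => (tu i).pow 2).div (tendsto_const_nhds.sub tv) (by norm_num)
    rw [sub_zero] at h1
    refine h1.congr' ?_
    filter_upwards [hsmall, self_mem_nhdsWithin] with s hs hs0
    have hs0' : s ≠ 0 := hs0
    have : 2 - v s ≠ 0 := by linarith
    simp only [div_pow]
    rw [← Finset.sum_div, hsum]
    field_simp
  have tv' : Tendsto (fun s => v' s / s) (𝓝[≠] 0) (𝓝 (2 * q)) := by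
    have h1 : Tendsto (fun s => (∑ i, u i s / s * u' i s) / (1 - v s)) (𝓝[≠] 0)
        (𝓝 ((∑ i, a i * a i) / (1 - 0))) :=
      (tendsto_finsetSum _ fun i _ => (tu i).mul (tu' i)).div (tendsto_const_nhds.sub tv)
        (by norm_num)
    rw [sub_zero, div_one, show ∑ i, a i * a i = 2 * q by
      rw [hq, mul_div_cancel₀ _ two_ne_zero]
      exact Finset.sum_congr rfl fun i _ => (sq (a i)).symm] at h1
    refine h1.congr' ?_
    filter_upwards [hsmall] with s hs
    have : 1 - v s ≠ 0 := by linarith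
    have h2 : ∑ i, u i s / s * u' i s = (1 - v s) * v' s / s := by
      rw [← hsum', Finset.sum_div]
      exact Finset.sum_congr rfl fun i _ => by ring
    rw [h2]
    field_simp
  -- This is the derivative of `t ↦ u / v` at `s = t⁻¹`, with the factor `-s²` from the inversion
  -- distributed so that each quotient has a limit. The limit simplifies to `a / q`.
  set W : ℝ → KnotEuclidean n := fun s => WithLp.toLp 2 fun i =>
    -(u' i s * (v s / s ^ 2) - u i s / s * (v' s / s)) / (v s / s ^ 2) ^ 2 with hW
  have tW : Tendsto W (𝓝[≠] 0)
      (𝓝 (WithLp.toLp 2 fun i => -(a i * q - a i * (2 * q)) / q ^ 2)) := by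
    refine ((PiLp.continuous_toLp 2 _).tendsto _).comp (tendsto_pi_nhds.2 fun i => ?_)
    exact (((tu' i).mul tv2).sub ((tu i).mul tv')).neg.div (tv2.pow 2) (pow_ne_zero 2 hq0)
  refine ⟨_, (tW.comp tendsto_inv₀_cobounded').congr' ?_⟩
  filter_upwards [Bornology.eventually_ne_cobounded (0 : ℝ)] with t ht
  have hs0 : t⁻¹ ≠ 0 := inv_ne_zero ht
  have hv1 : v t⁻¹ ≠ 0 := sub_ne_zero.2 (hne _ hs0).symm
  refine Eq.symm (HasDerivAt.deriv ?_)
  rw [hasDerivAt_euclidean_iff]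
  intro i
  have h1 : HasDerivAt (fun s => u i s / v s)
      ((u' i t⁻¹ * v t⁻¹ - u i t⁻¹ * v' t⁻¹) / v t⁻¹ ^ 2) t⁻¹ := (hud i _).div (hvd _) hv1
  have h2 := HasDerivAt.comp t h1 (hasDerivAt_inv ht)
  refine h2.congr_deriv ?_
  simp only [hW, Function.comp]
  field_simp

end Asymptotics

/-! ### Knots through the north pole. -/

theorem sphericalCompletion_northPole {n : ℕ} (κ : ℝ → KnotEuclidean n) :
    sphericalCompletion κ (northPole 1) = northPole n := by
  simp [sphericalCompletion]

theorem sphericalCompletion_stereoInclusion {n : ℕ} (κ : ℝ → KnotEuclidean n) (t : ℝ) :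
    sphericalCompletion κ (stereoInclusion (lineHomeo t)) = stereoInclusion (κ t) := by
  rw [sphericalCompletion, if_neg (stereoInclusion_ne_northPole _)]
  congr 2
  exact congrArg (fun x : KnotEuclidean 1 => x 0) (stereoProj_stereoCoords (lineHomeo t))

theorem stereoCoords_lineHomeo (t : ℝ) :
    stereoCoords (lineHomeo t) = !₂[2 * t / (1 + t ^ 2), (t ^ 2 - 1) / (1 + t ^ 2)] := by
  ext i
  fin_cases i
  · refine (stereoCoords_castSucc (lineHomeo t) 0).trans ?_
    rw [norm_lineHomeo, sq_abs, add_comm (t ^ 2)]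
    change 2 * lineHomeo.symm (lineHomeo t) / _ = _
    rw [Homeomorph.symm_apply_apply]
    rfl
  · refine (stereoCoords_last (lineHomeo t)).trans ?_
    rw [norm_lineHomeo, sq_abs, add_comm (t ^ 2)]
    rfl

theorem circleCurve_northPole {s : ℝ} (hs : s ≠ 0) :
    circleCurve (northPole 1) s = stereoInclusion (lineHomeo s⁻¹) := by
  apply Subtype.ext
  refine Eq.trans ?_ (stereoCoords_lineHomeo s⁻¹).symm
  have h0 : 1 + s ^ 2 ≠ 0 := by positivity
  have h1 : s ^ 2 + 1 ≠ 0 := by positivity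
  have e0 : (northPole 1).1 0 = 0 := by simp [northPole]
  have e1 : (northPole 1).1 1 = 1 := by simp [northPole]
  ext i
  fin_cases i
  · simp only [circleCurve, circleCoords, e0, e1]
    simp
    field_simp
    ring
  · simp only [circleCurve, circleCoords, e0, e1]
    simp
    field_simp
    ring

/-- The rational parametrization based at the south pole covers all of the circle except the north
pole, so regularity in that one chart makes the whole long curve `C¹`. -/
theorem exists_circleCurve_eq_stereoInclusion :
    ∃ S : KnotSphere 1, ∀ t, stereoInclusion (lineHomeo t) = circleCurve S (-t) := by
  refine ⟨⟨!₂[0, -1], mem_circle_of_sq_add_sq (by simp)⟩, fun t => Subtype.ext ?_⟩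
  refine (stereoCoords_lineHomeo t).trans ?_
  ext i
  fin_cases i
  · simp [circleCurve, circleCoords]
  · simp [circleCurve, circleCoords]

/-- A regular knot through the north pole has the knot type of a polynomial knot. -/
theorem exists_polynomialKnot_of_map_northPole {n : ℕ} {φ : KnotSphere 1 → KnotSphere n}
    (hφ : Continuous φ) (hinj : Function.Injective φ)
    (hreg : IsRegularOnCircle fun p => (φ p).1) (hN : φ (northPole 1) = northPole n) :
    ∃ κ : ℝ → KnotEuclidean n, IsPolynomialKnot κ ∧ SameKnotType (sphericalCompletion κ) φ := by
  have hne : ∀ t, φ (stereoInclusion (lineHomeo t)) ≠ northPole n := fun t h =>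
    stereoInclusion_ne_northPole _ (hinj (h.trans hN.symm))
  set β : ℝ → KnotEuclidean n := fun t => stereoProj (φ (stereoInclusion (lineHomeo t))).1 with hβ
  have hφβ : ∀ t, φ (stereoInclusion (lineHomeo t)) = stereoInclusion (β t) := fun t =>
    (stereoInclusion_stereoProj (hne t)).symm
  have hφβ' : ∀ t, (φ (stereoInclusion (lineHomeo t))).1 = stereoCoords (β t) := fun t =>
    congrArg Subtype.val (hφβ t)
  have hφc : Continuous fun p => (φ p).1 := continuous_subtype_val.comp hφ
  have hβd : ContDiff ℝ 1 β := by
    obtain ⟨S, hS⟩ := exists_circleCurve_eq_stereoInclusion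
    have h1 : ContDiff ℝ 1 fun t : ℝ => (φ (stereoInclusion (lineHomeo t))).1 := by
      simp only [hS]
      exact (hreg S).1.comp contDiff_neg
    rw [contDiff_euclidean] at h1 ⊢
    intro i
    exact (h1 _).div (contDiff_const.sub (h1 _)) fun t =>
      sub_ne_zero.2 (last_lt_one_of_ne_northPole (hne t)).ne'
  obtain ⟨A, hA⟩ := exists_tendsto_deriv_stereoProj (n := n)
    (y := fun s => (φ (circleCurve (northPole 1) s)).1) (hreg _).1
    (fun s => mem_sphere_zero_iff_norm.1 (φ _).2)
    (by simp only [circleCurve_zero, hN])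
    (fun s hs => by
      rw [circleCurve_northPole hs]
      exact (last_lt_one_of_ne_northPole (hne _)).ne) (hreg _).2
  have hβA : Tendsto (deriv β) (Bornology.cobounded ℝ) (𝓝 A) := by
    refine hA.congr' ?_
    filter_upwards [Bornology.eventually_ne_cobounded (0 : ℝ)] with t ht
    refine Filter.EventuallyEq.deriv_eq ?_
    filter_upwards [isOpen_ne.mem_nhds ht] with r hr
    rw [circleCurve_northPole (inv_ne_zero hr), inv_inv]
  obtain ⟨c, hc, hlow⟩ := hreg.exists_le_norm_sub hφc
    (Subtype.val_injective.comp hinj)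
  obtain ⟨d, hd, hupp⟩ := hreg.exists_norm_sub_le hφc (northPole 1)
  -- The Lipschitz bound at the pole says that `φ` does not leave it too fast, that is, `β` grows at
  -- least linearly.
  have hgrow : ∀ t : ℝ, d ^ 2 * (t ^ 2 + 1) ≤ ‖β t‖ ^ 2 + 1 := fun t => by
    have h1 := hupp (stereoInclusion (lineHomeo t))
    rw [hN, hφβ'] at h1
    have h2 := pow_le_pow_left₀ (by positivity) h1 2
    rw [mul_pow, stereoCoords_norm_sub_northPole_sq] at h2
    have h3 : ‖(stereoInclusion (lineHomeo t)).1 - (northPole 1 : KnotEuclidean 2)‖ ^ 2 =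
        4 / (t ^ 2 + 1) := by
      refine (stereoCoords_norm_sub_northPole_sq (lineHomeo t)).trans ?_
      rw [norm_lineHomeo, sq_abs]
    rw [h3, mul_div_assoc', div_le_div_iff₀ (by positivity) (by positivity)] at h2
    linarith
  -- In the chordal lower bound, stereographic projection contributes the factors `(s² + 1)(t² + 1)`
  -- and `(‖β s‖² + 1)(‖β t‖² + 1)`. Applying `hgrow` at `s` and at `t` cancels them, at the cost of
  -- `d ^ 2`.
  have hanti : ∀ s t, c * d ^ 2 * |s - t| ≤ ‖β s - β t‖ := fun s t => by
    have h1 := hlow (stereoInclusion (lineHomeo s)) (stereoInclusion (lineHomeo t))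
    simp only [hφβ'] at h1
    have h2 := pow_le_pow_left₀ (by positivity) h1 2
    have h3 : ‖(stereoInclusion (lineHomeo s)).1 - (stereoInclusion (lineHomeo t)).1‖ ^ 2 =
        4 * |s - t| ^ 2 / ((s ^ 2 + 1) * (t ^ 2 + 1)) := by
      refine (stereoCoords_norm_sub_sq (lineHomeo s) (lineHomeo t)).trans ?_
      rw [← lineHomeo_sub, norm_lineHomeo, norm_lineHomeo, norm_lineHomeo, sq_abs s, sq_abs t]
    rw [mul_pow, h3, stereoCoords_norm_sub_sq, mul_div_assoc',
      div_le_div_iff₀ (by positivity) (by positivity)] at h2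
    have h4 := mul_le_mul (hgrow s) (hgrow t) (by positivity) (by positivity)
    have h5 : c ^ 2 * (4 * |s - t| ^ 2) * ((d ^ 2 * (s ^ 2 + 1)) * (d ^ 2 * (t ^ 2 + 1))) ≤
        4 * ‖β s - β t‖ ^ 2 * ((s ^ 2 + 1) * (t ^ 2 + 1)) :=
      (mul_le_mul_of_nonneg_left h4 (by positivity)).trans h2
    have h6 : (c * d ^ 2 * |s - t|) ^ 2 ≤ ‖β s - β t‖ ^ 2 := by
      have hpos : 0 < 4 * ((s ^ 2 + 1) * (t ^ 2 + 1)) := by positivity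
      refine le_of_mul_le_mul_right ?_ hpos
      linarith
    exact le_of_sq_le_sq h6 (norm_nonneg _)
  obtain ⟨κ, hκ, h, θ, hop, hθ₁, hθ₂, hκh⟩ := exists_polynomialKnot_of_asymptotic
    (fun t => (hβd.differentiable one_ne_zero t).hasDerivAt) (hβd.continuous_deriv le_rfl) hβA
    (by positivity) hanti
  refine ⟨κ, hκ, _, _, orientationPreserving_line θ hθ₁ hθ₂, hop, funext fun p => ?_⟩
  rcases sphere_cases p with rfl | ⟨x, rfl⟩
  · simp [sphericalCompletion_northPole, sphereHomeo_northPole, hN]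
  · obtain ⟨t, rfl⟩ := lineHomeo.surjective x
    simp [sphericalCompletion_stereoInclusion, sphereHomeo_stereoInclusion, hφβ, hκh]

/-! ### Rotation to the north pole and the general case. -/

/-- Any point of a sphere of positive dimension is carried to the north pole by an
orientation-preserving homeomorphism which is the restriction of a linear isometry. -/
theorem exists_linearIsometry_map_northPole {n : ℕ} (hn : 0 < n) (p : KnotSphere n) :
    ∃ (L : KnotEuclidean (n + 1) ≃ₗᵢ[ℝ] KnotEuclidean (n + 1)) (g : KnotSphere n ≃ₜ KnotSphere n),
      OrientationPreserving g ∧ (∀ x, (g x).1 = L x.1) ∧ g p = northPole n := by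
  have hp : ‖p.1‖ = 1 := mem_sphere_zero_iff_norm.1 p.2
  have hN : ‖(northPole n).1‖ = 1 := mem_sphere_zero_iff_norm.1 (northPole n).2
  have hrefl : ∀ u z : KnotEuclidean (n + 1), ‖u‖ = 1 →
      (Submodule.span ℝ {u}).reflection z = (2 * inner ℝ u z) • u - z := fun u z hu => by
    rw [Submodule.reflection_singleton_apply, hu]
    simp [two_smul, two_mul, add_smul]
  -- The reflection fixes the line of `u` and negates its orthogonal complement. So `u` bisects `p`
  -- and the pole, or is orthogonal to the pole when `p` is antipodal to it.
  obtain ⟨u, hu, hup⟩ : ∃ u : KnotEuclidean (n + 1), ‖u‖ = 1 ∧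
      (Submodule.span ℝ {u}).reflection p.1 = (northPole n).1 := by
    by_cases h : p.1 + (northPole n).1 = 0
    · refine ⟨EuclideanSpace.single 0 1, by simp, ?_⟩
      rw [hrefl _ _ (by simp), eq_neg_of_add_eq_zero_left h]
      have : (0 : Fin (n + 1)) ≠ Fin.last n := by
        rw [Ne, Fin.ext_iff]
        exact hn.ne
      simp [northPole, this, EuclideanSpace.inner_single_left]
    · have h0 : ‖p.1 + (northPole n).1‖ ≠ 0 := norm_ne_zero_iff.2 h
      have hu : ‖‖p.1 + (northPole n).1‖⁻¹ • (p.1 + (northPole n).1)‖ = 1 := by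
        rw [norm_smul, norm_inv, norm_norm, inv_mul_cancel₀ h0]
      refine ⟨_, hu, ?_⟩
      rw [hrefl _ _ hu, real_inner_smul_left, smul_smul, inner_add_left,
        real_inner_self_eq_norm_sq, hp]
      have h1 := norm_add_sq_real p.1 (northPole n).1
      rw [hp, hN, real_inner_comm] at h1
      have h2 : 2 * (‖p.1 + (northPole n).1‖⁻¹ * (1 ^ 2 + inner ℝ (northPole n).1 p.1)) *
          ‖p.1 + (northPole n).1‖⁻¹ = 1 := by
        field_simp
        linarith
      rw [h2, one_smul, add_sub_cancel_left]
  have hrank : 1 < Module.rank ℝ (KnotEuclidean (n + 1)) := by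
    refine Module.lt_rank_of_lt_finrank ?_
    rw [finrank_euclideanSpace_fin]
    omega
  obtain ⟨γ, hγ⟩ := (isPathConnected_sphere hrank 0 zero_le_one).joinedIn u (by simpa using hu) p.1
    p.2
  have hγ' : ∀ t, ‖γ t‖ = 1 := fun t => mem_sphere_zero_iff_norm.1 (hγ t)
  -- The reflection in the line of `p` fixes `p`. Composing with it makes `L` homotopic to the
  -- identity: moving `u` along `γ` to `p` ends at the square of a reflection.
  set L := (Submodule.span ℝ {p.1}).reflection.trans (Submodule.span ℝ {u}).reflection with hL
  have hLs : ∀ x, x ∈ Metric.sphere (0 : KnotEuclidean (n + 1)) 1 ↔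
      L x ∈ Metric.sphere (0 : KnotEuclidean (n + 1)) 1 := fun x => by
    simp only [mem_sphere_zero_iff_norm, LinearIsometryEquiv.norm_map]
  refine ⟨L, L.toHomeomorph.subtype hLs, ?_, fun x => rfl, ?_⟩
  · have hmem : ∀ q : unitInterval × KnotSphere n,
        (Submodule.span ℝ {γ q.1}).reflection ((Submodule.span ℝ {p.1}).reflection q.2.1) ∈
          Metric.sphere (0 : KnotEuclidean (n + 1)) 1 := fun q => by
      rw [mem_sphere_zero_iff_norm, LinearIsometryEquiv.norm_map, LinearIsometryEquiv.norm_map]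
      exact mem_sphere_zero_iff_norm.1 q.2.2
    refine OrientationPreserving.of_homotopy
      { toFun := fun q => ⟨_, hmem q⟩
        continuous_toFun := ?_
        map_zero_left := fun x => ?_
        map_one_left := fun x => ?_ }
    · refine Continuous.subtype_mk ?_ _
      simp only [hrefl _ _ (hγ' _)]
      have := (Submodule.span ℝ {p.1}).reflection.continuous
      fun_prop
    · apply Subtype.ext
      simp only [γ.source]
      rfl
    · apply Subtype.ext
      simp only [γ.target, Submodule.reflection_reflection]
      rfl
  · apply Subtype.ext
    change (Submodule.span ℝ {u}).reflection ((Submodule.span ℝ {p.1}).reflection p.1) = _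
    rw [Submodule.reflection_mem_subspace_eq_self (Submodule.mem_span_singleton_self _), hup]

/-- A regular knot in a sphere has the knot type of a polynomial knot. -/
theorem exists_polynomialKnot_of_isRegularOnCircle {n : ℕ} (hn : 0 < n)
    {φ : KnotSphere 1 → KnotSphere n} (hφ : Continuous φ) (hinj : Function.Injective φ)
    (hreg : IsRegularOnCircle fun p => (φ p).1) :
    ∃ κ : ℝ → KnotEuclidean n, IsPolynomialKnot κ ∧ SameKnotType (sphericalCompletion κ) φ := by
  obtain ⟨L, g, hg, hgL, hgN⟩ := exists_linearIsometry_map_northPole hn (φ (northPole 1))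
  have hreg' : IsRegularOnCircle fun p => ((g ∘ φ) p).1 := fun P => by
    obtain ⟨h1, h2⟩ := hreg P
    simp only [Function.comp, hgL]
    refine ⟨L.contDiff.comp h1, ?_⟩
    have h3 := L.toContinuousLinearEquiv.hasFDerivAt.comp_hasDerivAt (0 : ℝ)
      (h1.differentiable one_ne_zero 0).hasDerivAt
    have h4 : deriv (fun s => L (φ (circleCurve P s)).1) 0 =
        L (deriv (fun s => (φ (circleCurve P s)).1) 0) := h3.deriv
    rw [h4]
    exact fun h => h2 (L.map_eq_zero_iff.1 h)
  obtain ⟨κ, hκ, f, k, hf, hk, h⟩ := exists_polynomialKnot_of_map_northPole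
    (g.continuous.comp hφ) (g.injective.comp hinj) hreg' hgN
  exact ⟨κ, hκ, f, g.trans k, hf, hg.trans hk, h⟩

/-- Since `stereoProj` is a differentiable left inverse of `stereoCoords`, a vanishing velocity on
the sphere would force a vanishing velocity of `φ`. -/
theorem IsRegularOnCircle.stereoCoords {n : ℕ} {φ : KnotSphere 1 → KnotEuclidean n}
    (hφ : IsRegularOnCircle φ) : IsRegularOnCircle fun p => _root_.stereoCoords (φ p) := by
  intro P
  obtain ⟨h1, h2⟩ := hφ P
  have h0 : ∀ s, ‖φ (circleCurve P s)‖ ^ 2 + 1 ≠ 0 := fun s => by positivity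
  have h3 : ContDiff ℝ 1 fun s => _root_.stereoCoords (φ (circleCurve P s)) := by
    have hn := h1.norm_sq ℝ
    have hi := contDiff_euclidean.1 h1
    rw [contDiff_euclidean]
    intro i
    refine Fin.lastCases ?_ (fun j => ?_) i
    · simp only [stereoCoords_last]
      exact (hn.sub contDiff_const).div (hn.add contDiff_const) h0
    · simp only [stereoCoords_castSucc]
      exact (contDiff_const.mul (hi j)).div (hn.add contDiff_const) h0
  refine ⟨h3, fun hz => h2 ?_⟩
  have h4 := (h3.differentiable one_ne_zero 0).hasDerivAt
  rw [hz, hasDerivAt_euclidean_iff] at h4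
  refine HasDerivAt.deriv (hasDerivAt_euclidean_iff.2 fun i => ?_)
  have h5 := (h4 i.castSucc).div ((h4 (Fin.last n)).const_sub 1) (sub_ne_zero.2
    (last_lt_one_of_ne_northPole (stereoInclusion_ne_northPole (φ (circleCurve P 0)))).ne')
  have h6 : HasDerivAt (fun s => stereoProj (_root_.stereoCoords (φ (circleCurve P s))) i) 0 0 :=
    h5.congr_deriv (by simp)
  simp only [stereoProj_stereoCoords] at h6
  exact h6

/-- Every `C²` knot in `S³`, and every `C²` knot in `ℝ³` (regarded as a knot in `S³` through
stereographic projection), has the same knot type as the spherical completion of a polynomial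
knot `ℝ → ℝ³`. -/
theorem mainTheorem4 :
    (∀ α : KnotSphere 1 → KnotSphere 3, IsCkEmbedding (𝓡 1) (𝓡 3) 2 α →
      ∃ κ : ℝ → KnotEuclidean 3, IsPolynomialKnot κ ∧
        SameKnotType (sphericalCompletion κ) α) ∧
    (∀ α : KnotSphere 1 → KnotEuclidean 3, IsCkEmbedding (𝓡 1) 𝓘(ℝ, KnotEuclidean 3) 2 α →
      ∃ κ : ℝ → KnotEuclidean 3, IsPolynomialKnot κ ∧
        SameKnotType (sphericalCompletion κ) (stereoInclusion ∘ α)) := by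
  refine ⟨fun α hα => ?_, fun α hα => ?_⟩
  · refine exists_polynomialKnot_of_isRegularOnCircle (by norm_num) hα.isEmbedding.continuous
      hα.isEmbedding.injective (.of_contMDiff
        ((contMDiff_coe_knotSphere 3).comp (hα.contMDiff.of_le one_le_two)) fun p => ?_)
    have h := mfderiv_comp (I := 𝓡 1) (I' := 𝓡 3) (I'' := 𝓘(ℝ, KnotEuclidean 4)) p
      ((contMDiff_coe_knotSphere 3 (m := 1)).mdifferentiableAt one_ne_zero)
      (hα.contMDiff.mdifferentiableAt two_ne_zero)
    have hinj := (mfderiv_coe_knotSphere_injective 3 (α p)).comp (hα.injective_mfderiv p)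
    exact fun x y hxy => hinj ((congrArg (· x) h).symm.trans (hxy.trans (congrArg (· y) h)))
  · exact exists_polynomialKnot_of_isRegularOnCircle (by norm_num)
      (continuous_stereoInclusion.comp hα.isEmbedding.continuous)
      (stereoInclusion_injective.comp hα.isEmbedding.injective)
      (IsRegularOnCircle.of_contMDiff (hα.contMDiff.of_le one_le_two)
        hα.injective_mfderiv).stereoCoords
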